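/- Fix $\eta>0$. For each dimension $d\ge 1$ let, on some probability space, $\theta_0=\theta_0^{(d)}$ and $\theta_*=\theta_*^{(d)}$ be random vectors in $\mathbb R^d$, each distributed as a normalized Gaussian $g/\|g\|$ with $g\sim N(0,I_d)$ (they may, but need not, be independent of each other). Let $(x_k,\epsilon_k)_{k\ge1}$ be i.i.d. and independent of $(\theta_0,\theta_*)$, where $x_k\sim N(0,I_d)$ and $\epsilon_k\sim N(0,\eta^2)$ are independent, and let $y_k=\langle x_k,\theta_*\rangle+\epsilon_k$. One-pass signSGD with step size $\eta/d$ is $$\theta_{k+1}=\theta_k-\frac{\eta}{d}\,\sigma\big((\langle x_{k+1},\theta_k\rangle-y_{k+1})\,x_{k+1}\big),\qquad k\ge 0,$$ where $\sigma$ is the sign function applied entrywise (the same constant $\eta$ is the step-size parameter and the standard deviation of the noise). Let $\mathcal R(\theta)=\frac12\|\theta-\theta_*\|^2$, and let $\rho:[0,\infty)\to\mathbb R$ be the solution of $$\frac{d\rho}{dt}=\eta\left(\frac{\eta}{2}-\frac{4\rho(t)}{\pi\sqrt{2\rho(t)+\eta^2}}\right),\qquad \rho(0)=\mathcal R(\theta_0),$$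 for each $d$ and each realization of $(\theta_0,\theta_*)$. Then for every $T>0$, $$\sup_{0\le t\le T}\big|\mathcal R(\theta_{\lfloor td\rfloor})-\rho(t)\big|\longrightarrow 0\quad\text{in probability as } d\to\infty .$$ -/

import Mathlib

open MeasureTheory ProbabilityTheory Filter Topology

namespace IsotropicSignSGD

/-- Parameter space `ℝ^d` with its Euclidean inner product and norm. -/
abbrev Vec (d : ℕ) : Type := EuclideanSpace ℝ (Fin d)

/-- The sign function applied entry-wise. -/
noncomputable def signVec {d : ℕ} (v : Vec d) : Vec d :=
  WithLp.toLp 2 (fun i => Real.sign (v i))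

/-- The noisy linear label `y = ⟨x, θ⋆⟩ + e` of the data point `x`. -/
noncomputable def label {d : ℕ} (θs x : Vec d) (e : ℝ) : ℝ :=
  inner ℝ x θs + e

/-- The gradient `(⟨x, θ⟩ - y) x` in `θ` of the quadratic loss `(⟨x, θ⟩ - y)² / 2`. -/
noncomputable def lossGrad {d : ℕ} (θ x : Vec d) (y : ℝ) : Vec d :=
  (inner ℝ x θ - y) • x

/-- One-pass signSGD with step size `η / d`, started at `θ₀`: step `k + 1` uses the fresh
sample `x (k + 1)` and its label with noise `e (k + 1)`. -/
noncomputable def iterate {d : ℕ} (η : ℝ) (θ₀ θs : Vec d) (x : ℕ → Vec d) (e : ℕ → ℝ) :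
    ℕ → Vec d
  | 0 => θ₀
  | k + 1 =>
    iterate η θ₀ θs x e k -
      (η / d) • signVec
        (lossGrad (iterate η θ₀ θs x e k) (x (k + 1)) (label θs (x (k + 1)) (e (k + 1))))

/-- The risk `R(θ) = ‖θ - θ⋆‖² / 2`. -/
noncomputable def risk {d : ℕ} (θs θ : Vec d) : ℝ :=
  ‖θ - θs‖ ^ 2 / 2

/-- The law of `g / ‖g‖` for a standard Gaussian vector `g` in `ℝ^d`. -/
noncomputable def normalizedGaussian (d : ℕ) : Measure (Vec d) :=
  (stdGaussian (Vec d)).map (fun g => ‖g‖⁻¹ • g)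

/-- The probabilistic setting in dimension `d`: initialization and target are (possibly
dependent) normalized Gaussian vectors, the pairs (data point, noise) are i.i.d. with law
`N(0, I_d) ⊗ N(0, η²)`, and the sequence of these pairs is independent of
(initialization, target). -/
structure Setting {Ω : Type*} [MeasurableSpace Ω] (P : Measure Ω) (η : ℝ) {d : ℕ}
    (θ₀ θs : Ω → Vec d) (x : ℕ → Ω → Vec d) (e : ℕ → Ω → ℝ) : Prop where
  measurable_init : Measurable θ₀
  measurable_target : Measurable θs
  measurable_data : ∀ k, Measurable (x k)
  measurable_noise : ∀ k, Measurable (e k)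
  law_init : P.map θ₀ = normalizedGaussian d
  law_target : P.map θs = normalizedGaussian d
  law_sample : ∀ k, P.map (fun ω => (x k ω, e k ω)) =
    (stdGaussian (Vec d)).prod (gaussianReal 0 (Real.toNNReal (η ^ 2)))
  iIndepFun_sample : iIndepFun (fun k ω => (x k ω, e k ω)) P
  indepFun_init : IndepFun (fun ω => (θ₀ ω, θs ω)) (fun ω k => (x k ω, e k ω)) P

/-- `ρ` solves `ρ' = η (η / 2 - 4 ρ / (π √(2 ρ + η²)))` on `[0, ∞)` with `ρ(0) = r₀`. -/
def IsRiskSolution (η r₀ : ℝ) (ρ : ℝ → ℝ) : Prop :=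
  ρ 0 = r₀ ∧ ∀ t : ℝ, 0 ≤ t →
    HasDerivWithinAt ρ
      (η * (η / 2 - 4 * ρ t / (Real.pi * Real.sqrt (2 * ρ t + η ^ 2)))) (Set.Ici 0) t

end IsotropicSignSGD

/-! Let `v = θ - θ⋆`. The update changes `v` by `-(η/d) s`, where `s` has entries `±1` almost
surely, so `‖s‖² = d` and `‖v‖²/2` changes by exactly `-(η/d)⟨v, s⟩ + η²/(2d)`. Given the coordinate
`x i` of the sample, the residual is `v i * x i` plus an independent Gaussian of variance `‖v‖² - (v
i)² + η²`. Linearising the mean of its sign gives `E (s i) = (2/π) v i / √(‖v‖² + η²) + O(|v i|³)`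
(`abs_meanSign_sub_le`). Hence `E⟨v, s⟩` is the drift of the equation up to a multiple of `∑ (v i)⁴`
(`abs_drift_sub_le`), and the risk follows an Euler scheme of step `1/d` with two perturbations.

The first is a martingale. All coordinates of `s` share the sign of the residual, so `⟨v, s⟩²` is at
most the square of `∑ (v i) sign (x i)`, whose mean is at most `‖v‖²` because the signs are
uncorrelated (`integral_sq_inner_signStep_le`). Over `T d` steps the total variance is `O(1/d)`, and
Doob's inequality controls all partial sums at once.

The second is the drift error, which is small as long as the error vector is spread over its
coordinates. Initially `E ∑ (v i)⁴ = O(1/d)` by rotation invariance of the normalized Gaussian. This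
persists because `v i * E (s i) ≥ 0` (`meanSign_mul_nonneg`): the odd-order terms in the expansions
of `‖v‖²` and `∑ (v i)⁴` only decrease the means (`integral_quartic_succ_le`). Markov's inequality
then bounds the sum of the errors.

The noise in the labels keeps the residual variance above `η²`, so all linearisation constants are
uniform in `v`. The rate of the equation is globally Lipschitz on `[0, ∞)`. No stopping time is
therefore needed, and a discrete Grönwall argument (`abs_sub_le_of_perturbed_euler`) concludes. -/

namespace IsotropicSignSGD

/-! ### Elementary properties of the sign function. -/

section Sign

lemma measurable_realSign : Measurable Real.sign := by
  unfold Real.sign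
  exact Measurable.ite (measurableSet_lt measurable_id measurable_const) measurable_const
    (Measurable.ite (measurableSet_lt measurable_const measurable_id) measurable_const
      measurable_const)

lemma abs_realSign_le_one (r : ℝ) : |Real.sign r| ≤ 1 := by
  rcases Real.sign_apply_eq r with h | h | h <;> rw [h] <;> norm_num

lemma realSign_mul (a b : ℝ) : Real.sign (a * b) = Real.sign a * Real.sign b := by
  rcases lt_trichotomy a 0 with ha | rfl | ha <;> rcases lt_trichotomy b 0 with hb | rfl | hb
  · rw [Real.sign_of_pos (mul_pos_of_neg_of_neg ha hb), Real.sign_of_neg ha, Real.sign_of_neg hb]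
    norm_num
  · simp
  · rw [Real.sign_of_neg (mul_neg_of_neg_of_pos ha hb), Real.sign_of_neg ha, Real.sign_of_pos hb]
    norm_num
  · simp
  · simp
  · simp
  · rw [Real.sign_of_neg (mul_neg_of_pos_of_neg ha hb), Real.sign_of_pos ha, Real.sign_of_neg hb]
    norm_num
  · simp
  · rw [Real.sign_of_pos (mul_pos ha hb), Real.sign_of_pos ha, Real.sign_of_pos hb]
    norm_num

lemma realSign_mul_self (a : ℝ) : a * Real.sign a = |a| := by
  rcases lt_trichotomy a 0 with ha | rfl | ha
  · rw [Real.sign_of_neg ha, abs_of_neg ha]; ring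
  · simp
  · rw [Real.sign_of_pos ha, abs_of_pos ha]; ring

lemma realSign_pow_three (a : ℝ) : Real.sign a ^ 3 = Real.sign a := by
  rcases Real.sign_apply_eq a with h | h | h <;> rw [h] <;> norm_num

lemma realSign_sq_le_one (a : ℝ) : Real.sign a ^ 2 ≤ 1 := by
  rcases Real.sign_apply_eq a with h | h | h <;> rw [h] <;> norm_num

lemma realSign_sq_eq_one {a : ℝ} (ha : a ≠ 0) : Real.sign a ^ 2 = 1 := by
  rcases Real.sign_apply_eq_of_ne_zero a ha with h | h <;> rw [h] <;> norm_num

end Sign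

/-! ### Mean of the sign of a shifted centered Gaussian. -/

section Shifted

lemma integral_realSign_neg_add_gaussianReal (v : NNReal) (a : ℝ) :
    ∫ w, Real.sign (-a + w) ∂gaussianReal 0 v = - ∫ w, Real.sign (a + w) ∂gaussianReal 0 v := by
  have h := gaussianReal_map_neg (μ := 0) (v := v)
  rw [neg_zero] at h
  conv_rhs => rw [← h]
  have hm : Measurable fun w : ℝ => Real.sign (a + w) :=
    measurable_realSign.comp (by fun_prop)
  rw [integral_map (by fun_prop) hm.aestronglyMeasurable, ← integral_neg]
  refine integral_congr_ae (ae_of_all _ fun w => ?_)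
  show Real.sign (-a + w) = - Real.sign (a + -w)
  rw [← Real.sign_neg]; congr 1; ring

/-- Integrating against a centered Gaussian turns a shifted sign into an interval probability. -/
lemma integral_realSign_add_gaussianReal {v : NNReal} (hv : v ≠ 0) {a : ℝ} (ha : 0 ≤ a) :
    ∫ w, Real.sign (a + w) ∂gaussianReal 0 v = ∫ w in (-a)..a, gaussianPDFReal 0 v w := by
  have hint : ∀ b : ℝ, Integrable (fun w => Real.sign (b + w)) (gaussianReal 0 v) := fun b =>
    Integrable.of_bound (measurable_realSign.comp (by fun_prop)).aestronglyMeasurable 1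
      (ae_of_all _ fun w => by simpa using abs_realSign_le_one (b + w))
  have hodd : ∫ w, Real.sign (a + w) ∂gaussianReal 0 v
      = - ∫ w, Real.sign (-a + w) ∂gaussianReal 0 v := by
    rw [integral_realSign_neg_add_gaussianReal, neg_neg]
  have : NullSingletonClass (gaussianReal 0 v) := nullSingletonClass_gaussianReal hv
  -- By oddness the mean is half the mean of this difference, which is `2` on the interval between
  -- `-a` and `a` and `0` outside, up to null endpoints.
  have hsum : ∫ w, (Real.sign (a + w) - Real.sign (-a + w)) ∂gaussianReal 0 v
      = ∫ w, (Set.Ioc (-a) a).indicator (fun _ => (2 : ℝ)) w ∂gaussianReal 0 v := by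
    refine integral_congr_ae ?_
    have h1 : ∀ᵐ w ∂gaussianReal 0 v, w ≠ a := by simp [ae_iff]
    have h2 : ∀ᵐ w ∂gaussianReal 0 v, w ≠ -a := by simp [ae_iff]
    filter_upwards [h1, h2] with w hw1 hw2
    by_cases hw : w ∈ Set.Ioc (-a) a
    · rw [Set.indicator_of_mem hw, Real.sign_of_pos (by linarith [hw.1]),
        Real.sign_of_neg (by linarith [lt_of_le_of_ne hw.2 hw1])]
      norm_num
    · rw [Set.indicator_of_notMem hw]
      rcases lt_or_gt_of_ne hw2 with h | h
      · rw [Real.sign_of_neg (by linarith), Real.sign_of_neg (by linarith)]; norm_num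
      · have : a < w := by
          by_contra hcon
          exact hw ⟨h, not_lt.mp hcon⟩
        rw [Real.sign_of_pos (by linarith), Real.sign_of_pos (by linarith)]; norm_num
  rw [integral_sub (hint a) (hint (-a)), integral_indicator measurableSet_Ioc,
    setIntegral_const] at hsum
  have hreal : (gaussianReal 0 v).real (Set.Ioc (-a) a)
      = ∫ w in (-a)..a, gaussianPDFReal 0 v w := by
    rw [measureReal_def, gaussianReal_apply_eq_integral _ hv, ENNReal.toReal_ofReal,
      intervalIntegral.integral_of_le (by linarith)]
    exact setIntegral_nonneg measurableSet_Ioc fun w _ => gaussianPDFReal_nonneg _ _ _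
  rw [hreal, smul_eq_mul] at hsum
  linarith

/-- The tangent-line inequality `1 + u ≤ exp u` is enough: a quadratic lower bound on the density
integrates over `[-a, a]` to a cubic error. -/
lemma gaussianPDFReal_zero_bounds {v : NNReal} (hv : v ≠ 0) (w : ℝ) :
    (Real.sqrt (2 * Real.pi * v))⁻¹ * (1 - w ^ 2 / (2 * v)) ≤ gaussianPDFReal 0 v w ∧
      gaussianPDFReal 0 v w ≤ (Real.sqrt (2 * Real.pi * v))⁻¹ := by
  have hv' : (0 : ℝ) < v := by positivity
  rw [gaussianPDFReal_def]
  simp only [sub_zero]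
  constructor
  · have h := Real.add_one_le_exp (-w ^ 2 / (2 * (v : ℝ)))
    refine mul_le_mul_of_nonneg_left ?_ (by positivity)
    have : 1 - w ^ 2 / (2 * (v : ℝ)) = -w ^ 2 / (2 * v) + 1 := by ring
    linarith
  · have h : Real.exp (-w ^ 2 / (2 * (v : ℝ))) ≤ 1 := by
      rw [Real.exp_le_one_iff, neg_div]
      have : 0 ≤ w ^ 2 / (2 * (v : ℝ)) := by positivity
      linarith
    exact mul_le_of_le_one_right (by positivity) h

/-- The mean of a shifted sign has the sign of the shift and is linear up to a cubic error. -/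
lemma integral_realSign_add_gaussianReal_bounds {v : NNReal} (hv : v ≠ 0) {a : ℝ} (ha : 0 ≤ a) :
    0 ≤ ∫ w, Real.sign (a + w) ∂gaussianReal 0 v ∧
    |∫ w, Real.sign (a + w) ∂gaussianReal 0 v - 2 * (Real.sqrt (2 * Real.pi * v))⁻¹ * a|
      ≤ (Real.sqrt (2 * Real.pi * v))⁻¹ * a ^ 3 / v := by
  have hv' : (0 : ℝ) < v := by positivity
  rw [integral_realSign_add_gaussianReal hv ha]
  set c := (Real.sqrt (2 * Real.pi * v))⁻¹ with hc
  have hc0 : 0 ≤ c := by positivity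
  have hi : IntervalIntegrable (gaussianPDFReal 0 v) volume (-a) a :=
    (integrable_gaussianPDFReal 0 v).intervalIntegrable
  have hle : -a ≤ a := by linarith
  have hup : ∫ w in (-a)..a, gaussianPDFReal 0 v w ≤ ∫ _w in (-a)..a, c :=
    intervalIntegral.integral_mono_on hle hi (by simp)
      fun w _ => (gaussianPDFReal_zero_bounds hv w).2
  have hlow : ∫ _w in (-a)..a, c * (1 - a ^ 2 / (2 * v)) ≤ ∫ w in (-a)..a, gaussianPDFReal 0 v w :=
    intervalIntegral.integral_mono_on hle (by simp) hi fun w hw => by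
      refine le_trans (mul_le_mul_of_nonneg_left ?_ hc0) (gaussianPDFReal_zero_bounds hv w).1
      have : w ^ 2 ≤ a ^ 2 := sq_le_sq' hw.1 hw.2
      have : w ^ 2 / (2 * (v : ℝ)) ≤ a ^ 2 / (2 * v) := by gcongr
      linarith
  rw [intervalIntegral.integral_const, smul_eq_mul] at hup hlow
  refine ⟨intervalIntegral.integral_nonneg hle fun w _ => gaussianPDFReal_nonneg _ _ _, ?_⟩
  have e1 : (a - -a) * (c * (1 - a ^ 2 / (2 * v))) = 2 * c * a - c * a ^ 3 / v := by
    field_simp; ring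
  have e2 : 0 ≤ c * a ^ 3 / v := by positivity
  rw [abs_le]
  constructor <;> nlinarith

/-- Source of the constant in the drift: multiplied by the density factor `2 / √(2π)` it gives `2 /
π`. -/
lemma integral_abs_gaussianReal : ∫ x, |x| ∂gaussianReal 0 1 = Real.sqrt (2 / Real.pi) := by
  rw [integral_gaussianReal_eq_integral_smul one_ne_zero]
  have h1 : ∀ x : ℝ, gaussianPDFReal 0 1 x • |x|
      = (fun y => (Real.sqrt (2 * Real.pi))⁻¹ *
          (y ^ (1 : ℝ) * Real.exp (-(1 / 2) * y ^ (2 : ℝ)))) |x| := by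
    intro x
    simp only [gaussianPDFReal_def, sub_zero, smul_eq_mul, NNReal.coe_one, mul_one, Real.rpow_one,
      Real.rpow_two, sq_abs]
    rw [show -x ^ 2 / 2 = -(1 / 2) * x ^ 2 by ring]
    ring
  simp_rw [h1]
  rw [integral_comp_abs (f := fun y => (Real.sqrt (2 * Real.pi))⁻¹ *
          (y ^ (1 : ℝ) * Real.exp (-(1 / 2) * y ^ (2 : ℝ)))), integral_const_mul,
    integral_rpow_mul_exp_neg_mul_rpow (by norm_num) (by norm_num) (by norm_num)]
  norm_num
  have hp := Real.pi_pos
  have h2 := Real.mul_self_sqrt (show (0 : ℝ) ≤ 2 by norm_num)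
  field_simp
  linarith

end Shifted

/-! ### Joint law of one coordinate and the rest of the residual. -/

section Law

variable {d : ℕ}

/-- The law of one sample (data point, noise). -/
noncomputable abbrev sampleLaw (d : ℕ) (η : ℝ) : Measure (Vec d × ℝ) :=
  (stdGaussian (Vec d)).prod (gaussianReal 0 (Real.toNNReal (η ^ 2)))

lemma charFunDual_gaussianReal_zero (v : NNReal) (L : StrongDual ℝ ℝ) :
    charFunDual (gaussianReal 0 v) L = Complex.exp (-((L 1) ^ 2 * v : ℝ) / 2) := by
  have h : ∀ x : ℝ, L x = L 1 * x := fun x => by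
    have := L.map_smul x 1
    simp only [smul_eq_mul, mul_one] at this
    rw [this, mul_comm]
  have h' : charFunDual (gaussianReal 0 v) L = charFun (gaussianReal 0 v) (L 1) := by
    rw [charFunDual_apply, charFun_apply_real]
    refine integral_congr_ae (ae_of_all _ fun x => ?_)
    show Complex.exp ((L x : ℂ) * _) = _
    rw [h x, Complex.ofReal_mul]
  rw [h', charFun_gaussianReal]
  congr 1
  push_cast
  ring

/-- Up to the coordinate `x i`, the residual is an independent centered Gaussian. -/
lemma sampleLaw_map_coord (η : ℝ) (v : Vec d) (i : Fin d) :
    (sampleLaw d η).map (fun z => (z.1 i, inner ℝ z.1 v - z.2 - v i * z.1 i)) =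
      (gaussianReal 0 1).prod
        (gaussianReal 0 (Real.toNNReal (‖v‖ ^ 2 - v i ^ 2 + η ^ 2))) := by
  have hvi : v i ^ 2 ≤ ‖v‖ ^ 2 := by
    rw [EuclideanSpace.real_norm_sq_eq]
    exact Finset.single_le_sum (f := fun j => v j ^ 2) (fun j _ => sq_nonneg _) (Finset.mem_univ i)
  let L : (Vec d × ℝ) →L[ℝ] (ℝ × ℝ) :=
    ((EuclideanSpace.proj i).comp (ContinuousLinearMap.fst ℝ (Vec d) ℝ)).prod
      ((innerSL ℝ v).comp (ContinuousLinearMap.fst ℝ (Vec d) ℝ)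
        - ContinuousLinearMap.snd ℝ (Vec d) ℝ
        - v i • (EuclideanSpace.proj i).comp (ContinuousLinearMap.fst ℝ (Vec d) ℝ))
  have hL : (fun z : Vec d × ℝ => (z.1 i, inner ℝ z.1 v - z.2 - v i * z.1 i)) = L := by
    funext z
    simp [L, real_inner_comm]
  rw [hL]
  apply Measure.ext_of_charFunDual
  ext M
  rw [charFunDual_map, charFunDual_prod, charFunDual_prod, charFunDual_stdGaussian,
    charFunDual_gaussianReal_zero, charFunDual_gaussianReal_zero, charFunDual_gaussianReal_zero]
  have hM : ∀ p : ℝ × ℝ, M p = p.1 * M (1, 0) + p.2 * M (0, 1) := fun p => by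
    have : p = p.1 • ((1 : ℝ), (0 : ℝ)) + p.2 • ((0 : ℝ), (1 : ℝ)) := by ext <;> simp
    conv_lhs => rw [this]
    rw [map_add, map_smul, map_smul]; simp
  set α := M (1, 0)
  set β := M (0, 1)
  have h1 : (M ∘SL L) ∘SL ContinuousLinearMap.inl ℝ (Vec d) ℝ
      = innerSL ℝ ((α - β * v i) • EuclideanSpace.single i (1 : ℝ) + β • v) := by
    ext x
    simp only [ContinuousLinearMap.comp_apply, ContinuousLinearMap.inl_apply, innerSL_apply_apply,
      hM (L _), inner_add_left, inner_smul_left, EuclideanSpace.inner_single_left]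
    simp [L]
    ring
  have h2 : ((M ∘SL L) ∘SL ContinuousLinearMap.inr ℝ (Vec d) ℝ) 1 = -β := by
    simp only [ContinuousLinearMap.comp_apply, ContinuousLinearMap.inr_apply, hM (L _)]
    simp [L]
  have h3 : (M ∘SL ContinuousLinearMap.inl ℝ ℝ ℝ) 1 = α := by simp [α]
  have h4 : (M ∘SL ContinuousLinearMap.inr ℝ ℝ ℝ) 1 = β := by simp [β]
  -- Subtracting `v i * x i` from the residual cancels the mixed term in `α β`. The characteristic
  -- function then factorises, which is the claimed independence.
  have hn : ‖(α - β * v i) • EuclideanSpace.single i (1 : ℝ) + β • v‖ ^ 2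
      = α ^ 2 + β ^ 2 * (‖v‖ ^ 2 - v i ^ 2) := by
    rw [norm_add_sq_real, norm_smul, norm_smul, inner_smul_left, inner_smul_right,
      EuclideanSpace.inner_single_left]
    simp only [PiLp.norm_single, mul_pow, Real.norm_eq_abs, sq_abs]
    simp
    ring
  rw [h1, h2, h3, h4, innerSL_apply_norm, ← Complex.exp_add, ← Complex.exp_add,
    Real.coe_toNNReal _ (by positivity), Real.coe_toNNReal _ (by nlinarith [sq_nonneg η])]
  congr 1
  rw [← Complex.ofReal_pow, hn]
  push_cast
  ring

end Law

/-! ### The sign step for a fixed error vector: mean and second moment. -/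

section Step

variable {d : ℕ}

/-- The sign of the loss gradient as a function of the error vector `v = θ - θ⋆` and the sample. -/
noncomputable def signStep (v : Vec d) (z : Vec d × ℝ) : Vec d :=
  signVec ((inner ℝ z.1 v - z.2) • z.1)

lemma signStep_apply (v : Vec d) (z : Vec d × ℝ) (i : Fin d) :
    signStep v z i = Real.sign (inner ℝ z.1 v - z.2) * Real.sign (z.1 i) := by
  simp [signStep, signVec, realSign_mul]

lemma signStep_apply' (v : Vec d) (z : Vec d × ℝ) (i : Fin d) :
    signStep v z i = Real.sign ((inner ℝ z.1 v - z.2) * z.1 i) := by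
  simp [signStep, signVec]

lemma abs_signStep_le_one (v : Vec d) (z : Vec d × ℝ) (i : Fin d) : |signStep v z i| ≤ 1 := by
  rw [signStep_apply']; exact abs_realSign_le_one _

lemma signStep_sq_le_one (v : Vec d) (z : Vec d × ℝ) (i : Fin d) : signStep v z i ^ 2 ≤ 1 := by
  rw [signStep_apply']; exact realSign_sq_le_one _

lemma signStep_pow_three (v : Vec d) (z : Vec d × ℝ) (i : Fin d) :
    signStep v z i ^ 3 = signStep v z i := by
  rw [signStep_apply']; exact realSign_pow_three _

lemma norm_signStep_sq_le (v : Vec d) (z : Vec d × ℝ) : ‖signStep v z‖ ^ 2 ≤ d := by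
  rw [EuclideanSpace.real_norm_sq_eq]
  calc ∑ i, signStep v z i ^ 2 ≤ ∑ _i : Fin d, (1 : ℝ) :=
        Finset.sum_le_sum fun i _ => signStep_sq_le_one v z i
    _ = d := by simp

lemma measurable_signStep : Measurable fun p : Vec d × (Vec d × ℝ) => signStep p.1 p.2 := by
  unfold signStep signVec
  refine (WithLp.measurable_toLp 2 (Fin d → ℝ)).comp (measurable_pi_lambda _ fun i => ?_)
  refine measurable_realSign.comp ?_
  simp only [PiLp.smul_apply, smul_eq_mul]
  fun_prop

lemma measurable_signStep_apply (i : Fin d) :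
    Measurable fun p : Vec d × (Vec d × ℝ) => signStep p.1 p.2 i := by
  simp_rw [signStep_apply']
  exact measurable_realSign.comp (by fun_prop)

lemma integrable_signStep_apply (η : ℝ) (v : Vec d) (i : Fin d) :
    Integrable (fun z => signStep v z i) (sampleLaw d η) :=
  Integrable.of_bound
    ((measurable_signStep_apply i).comp (measurable_const.prodMk measurable_id)).aestronglyMeasurable
    1 (ae_of_all _ fun z => by simpa using abs_signStep_le_one v z i)

/-- The mean of the `i`-th coordinate of the sign step. -/
noncomputable def meanSign (η : ℝ) (v : Vec d) (i : Fin d) : ℝ :=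
  ∫ z, signStep v z i ∂sampleLaw d η

/-- The conditional variance of the residual given the `i`-th coordinate of the data point. -/
noncomputable def residualVar (η : ℝ) (v : Vec d) (i : Fin d) : NNReal :=
  Real.toNNReal (‖v‖ ^ 2 - v i ^ 2 + η ^ 2)

lemma sq_apply_le_norm_sq (v : Vec d) (i : Fin d) : v i ^ 2 ≤ ‖v‖ ^ 2 := by
  rw [EuclideanSpace.real_norm_sq_eq]
  exact Finset.single_le_sum (f := fun j => v j ^ 2) (fun j _ => sq_nonneg _) (Finset.mem_univ i)

lemma coe_residualVar (η : ℝ) (v : Vec d) (i : Fin d) :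
    (residualVar η v i : ℝ) = ‖v‖ ^ 2 - v i ^ 2 + η ^ 2 :=
  Real.coe_toNNReal _ (by nlinarith [sq_nonneg η, sq_apply_le_norm_sq v i])

lemma residualVar_ne_zero {η : ℝ} (hη : 0 < η) (v : Vec d) (i : Fin d) :
    residualVar η v i ≠ 0 := by
  rw [← NNReal.coe_ne_zero, coe_residualVar]
  nlinarith [pow_pos hη 2, sq_apply_le_norm_sq v i]

lemma measurable_coord (v : Vec d) (i : Fin d) :
    Measurable fun z : Vec d × ℝ => (z.1 i, inner ℝ z.1 v - z.2 - v i * z.1 i) := by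
  fun_prop

/-- A step has a zero entry only if `x i` or the residual vanishes. Both have atomless laws, the
residual because its variance given `x i` is at least `η² > 0`. -/
lemma ae_signStep_sq_eq_one {η : ℝ} (hη : 0 < η) (v : Vec d) :
    ∀ᵐ z ∂sampleLaw d η, ∀ i, signStep v z i ^ 2 = 1 := by
  rw [ae_all_iff]
  intro i
  have hw : NullSingletonClass (gaussianReal 0 (residualVar η v i)) :=
    nullSingletonClass_gaussianReal (residualVar_ne_zero hη v i)
  have hx : NullSingletonClass (gaussianReal 0 1) := nullSingletonClass_gaussianReal one_ne_zero
  have h : ∀ᵐ p ∂(gaussianReal 0 1).prod (gaussianReal 0 (residualVar η v i)),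
      p.1 ≠ 0 ∧ v i * p.1 + p.2 ≠ 0 := by
    rw [Measure.ae_prod_iff_ae_ae]
    · have h1 : ∀ᵐ x ∂gaussianReal 0 1, x ≠ 0 := by simp [ae_iff]
      filter_upwards [h1] with x hx
      have h2 : ∀ᵐ w ∂gaussianReal 0 (residualVar η v i), w ≠ -(v i * x) := by simp [ae_iff]
      filter_upwards [h2] with w hw
      exact ⟨hx, fun h => hw (by linarith)⟩
    · refine MeasurableSet.inter (measurableSet_eq_fun (by fun_prop) (by fun_prop)).compl
        (measurableSet_eq_fun (by fun_prop) (by fun_prop)).compl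
  unfold residualVar at h
  rw [← sampleLaw_map_coord] at h
  filter_upwards [ae_of_ae_map (measurable_coord v i).aemeasurable h] with z hz
  rw [signStep_apply']
  refine realSign_sq_eq_one (mul_ne_zero ?_ hz.1)
  have := hz.2
  simpa using this

lemma meanSign_eq (η : ℝ) (v : Vec d) (i : Fin d) :
    meanSign η v i = ∫ x, (∫ w, Real.sign (v i * x + w) ∂gaussianReal 0 (residualVar η v i))
      * Real.sign x ∂gaussianReal 0 1 := by
  have hm : Measurable fun p : ℝ × ℝ => Real.sign (v i * p.1 + p.2) * Real.sign p.1 :=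
    (measurable_realSign.comp (by fun_prop)).mul (measurable_realSign.comp (by fun_prop))
  have h1 : meanSign η v i = ∫ p, Real.sign (v i * p.1 + p.2) * Real.sign p.1
      ∂(gaussianReal 0 1).prod (gaussianReal 0 (residualVar η v i)) := by
    unfold residualVar
    rw [← sampleLaw_map_coord, integral_map (measurable_coord v i).aemeasurable
      hm.aestronglyMeasurable]
    refine integral_congr_ae (ae_of_all _ fun z => ?_)
    show signStep v z i = _
    rw [signStep_apply]
    congr 2
    ring
  rw [h1, integral_prod]
  · simp_rw [integral_mul_const]
  · refine Integrable.of_bound hm.aestronglyMeasurable 1 (ae_of_all _ fun p => ?_)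
    rw [norm_mul]
    exact mul_le_one₀ (abs_realSign_le_one _) (abs_nonneg _) (abs_realSign_le_one _)

/-- The linearisation of the mean of a shifted sign, for shifts of either sign. -/
lemma shiftedSign_bounds {v : NNReal} (hv : v ≠ 0) (a : ℝ) :
    0 ≤ a * ∫ w, Real.sign (a + w) ∂gaussianReal 0 v ∧
    |∫ w, Real.sign (a + w) ∂gaussianReal 0 v - 2 * (Real.sqrt (2 * Real.pi * v))⁻¹ * a|
      ≤ (Real.sqrt (2 * Real.pi * v))⁻¹ * |a| ^ 3 / v := by
  rcases le_total 0 a with ha | ha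
  · have h := integral_realSign_add_gaussianReal_bounds hv ha
    rw [abs_of_nonneg ha]
    exact ⟨mul_nonneg ha h.1, h.2⟩
  · have h := integral_realSign_add_gaussianReal_bounds hv (neg_nonneg.mpr ha)
    rw [integral_realSign_neg_add_gaussianReal] at h
    rw [abs_of_nonpos ha]
    refine ⟨mul_nonneg_of_nonpos_of_nonpos ha (by linarith [h.1]), ?_⟩
    rw [← abs_neg]
    convert h.2 using 2
    ring

/-- Given `x i`, the mean sign of the residual has the sign of `v i * x i`; multiplying by the sign
of `x i` leaves that of `v i`. Each coordinate is thus pushed towards zero on average, which is what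
keeps the error vector delocalised. -/
lemma meanSign_mul_nonneg {η : ℝ} (hη : 0 < η) (v : Vec d) (i : Fin d) :
    0 ≤ v i * meanSign η v i := by
  rw [meanSign_eq, ← integral_const_mul]
  refine integral_nonneg fun x => ?_
  have h := (shiftedSign_bounds (residualVar_ne_zero hη v i) (v i * x)).1
  show 0 ≤ v i * (_ * Real.sign x)
  rcases lt_trichotomy x 0 with hx | rfl | hx
  · rw [Real.sign_of_neg hx]
    nlinarith
  · simp
  · rw [Real.sign_of_pos hx]
    nlinarith

/-- The third absolute moment of the standard Gaussian. -/
noncomputable def thirdMoment : ℝ := ∫ x, |x| ^ 3 ∂gaussianReal 0 1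

lemma integrable_abs_pow_gaussianReal (n : ℕ) :
    Integrable (fun x : ℝ => |x| ^ n) (gaussianReal 0 1) :=
  (memLp_id_gaussianReal (μ := 0) (v := 1) n).integrable_norm_pow'

lemma thirdMoment_nonneg : 0 ≤ thirdMoment := integral_nonneg fun _ => by positivity

/-- There are two sources of error: the cubic remainder of the shifted sign, averaged over `x i` and
producing the third moment, and the replacement of the conditional variance by `‖v‖² + η²`. Both
variances are at least `η²`, so the constant depends on neither `v` nor `d`. -/
lemma abs_meanSign_sub_le {η : ℝ} (hη : 0 < η) (v : Vec d) (i : Fin d) :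
    |meanSign η v i - 2 / Real.pi * (v i / Real.sqrt (‖v‖ ^ 2 + η ^ 2))|
      ≤ (thirdMoment + 1) / η ^ 3 * |v i| ^ 3 := by
  have hp := Real.pi_pos
  have hτ0 := residualVar_ne_zero hη v i
  set V := residualVar η v i with hV
  have hVη : η ^ 2 ≤ V := by
    rw [hV, coe_residualVar]; linarith [sq_apply_le_norm_sq v i]
  have hVpos : (0 : ℝ) < V := by positivity
  set τ := Real.sqrt V with hτ
  have hτη : η ≤ τ := Real.le_sqrt_of_sq_le hVη
  have hτsq : τ ^ 2 = V := Real.sq_sqrt hVpos.le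
  set s := Real.sqrt (‖v‖ ^ 2 + η ^ 2) with hs
  have hssq : s ^ 2 = ‖v‖ ^ 2 + η ^ 2 := Real.sq_sqrt (by positivity)
  have hVs : τ ^ 2 + v i ^ 2 = s ^ 2 := by rw [hτsq, hssq, hV, coe_residualVar]; ring
  have hτpos : 0 < τ := hη.trans_le hτη
  have hs0 : 0 ≤ s := Real.sqrt_nonneg _
  have hτs : τ ≤ s := by nlinarith [sq_nonneg (v i)]
  have hspos : 0 < s := hτpos.trans_le hτs
  set c := (Real.sqrt (2 * Real.pi * V))⁻¹ with hc
  have hcτ : c = (Real.sqrt (2 * Real.pi))⁻¹ * τ⁻¹ := by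
    rw [hc, Real.sqrt_mul (by positivity), mul_inv]
  have hc0 : 0 ≤ c := by positivity
  set G : ℝ → ℝ := fun a => ∫ w, Real.sign (a + w) ∂gaussianReal 0 V with hG
  have hGm : Measurable fun x => G (v i * x) := by
    have : Measurable fun p : ℝ × ℝ => Real.sign (v i * p.1 + p.2) :=
      measurable_realSign.comp (by fun_prop)
    exact (this.stronglyMeasurable.integral_prod_right).measurable
  have hGint : Integrable (fun x => G (v i * x) * Real.sign x) (gaussianReal 0 1) := by
    refine Integrable.of_bound (hGm.mul measurable_realSign).aestronglyMeasurable 1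
      (ae_of_all _ fun x => ?_)
    rw [norm_mul]
    refine mul_le_one₀ ?_ (abs_nonneg _) (abs_realSign_le_one _)
    calc ‖G (v i * x)‖ ≤ 1 * (gaussianReal 0 V).real Set.univ :=
          norm_integral_le_of_norm_le_const (ae_of_all _ fun w => abs_realSign_le_one _)
      _ = 1 := by simp
  have habs : Integrable (fun x : ℝ => |x|) (gaussianReal 0 1) := by
    simpa using integrable_abs_pow_gaussianReal 1
  have hmain : |meanSign η v i - 2 * c * v i * Real.sqrt (2 / Real.pi)|
      ≤ c * |v i| ^ 3 / V * thirdMoment := by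
    rw [meanSign_eq, ← integral_abs_gaussianReal, ← integral_const_mul,
      ← integral_sub hGint (habs.const_mul _), thirdMoment, ← integral_const_mul]
    refine abs_integral_le_integral_abs.trans (integral_mono_of_nonneg
      (ae_of_all _ fun x => abs_nonneg _)
      ((integrable_abs_pow_gaussianReal 3).const_mul _) (ae_of_all _ fun x => ?_))
    show abs (G (v i * x) * Real.sign x - 2 * c * v i * |x|) ≤ c * |v i| ^ 3 / V * |x| ^ 3
    have h := (shiftedSign_bounds hτ0 (v i * x)).2
    rw [← realSign_mul_self x,
      show G (v i * x) * Real.sign x - 2 * c * v i * (x * Real.sign x)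
        = (G (v i * x) - 2 * c * (v i * x)) * Real.sign x by ring, abs_mul]
    calc |G (v i * x) - 2 * c * (v i * x)| * |Real.sign x|
        ≤ |G (v i * x) - 2 * c * (v i * x)| * 1 :=
          mul_le_mul_of_nonneg_left (abs_realSign_le_one x) (abs_nonneg _)
      _ ≤ c * |v i * x| ^ 3 / V := by rw [mul_one]; exact h
      _ = c * |v i| ^ 3 / V * (x * Real.sign x) ^ 3 := by
          rw [realSign_mul_self, abs_mul]; ring
  have hlin : 2 * c * v i * Real.sqrt (2 / Real.pi) = 2 / Real.pi * (v i / τ) := by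
    have h2 := Real.mul_self_sqrt (show (0 : ℝ) ≤ 2 by norm_num)
    have h3 := Real.mul_self_sqrt hp.le
    rw [hcτ, Real.sqrt_mul (by norm_num), Real.sqrt_div (by norm_num)]
    field_simp
    rw [sq, h3, mul_comm]
  have hb1 : c * |v i| ^ 3 / V * thirdMoment ≤ thirdMoment / η ^ 3 * |v i| ^ 3 := by
    have hc1 : c ≤ 1 / η := by
      rw [hcτ, one_div]
      have h1 : 1 ≤ Real.sqrt (2 * Real.pi) := by
        rw [Real.one_le_sqrt]; nlinarith [Real.pi_gt_three]
      calc (Real.sqrt (2 * Real.pi))⁻¹ * τ⁻¹ ≤ 1 * η⁻¹ := by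
            gcongr
            exact inv_le_one_of_one_le₀ h1
        _ = η⁻¹ := one_mul _
    have := thirdMoment_nonneg
    calc c * |v i| ^ 3 / V * thirdMoment ≤ 1 / η * |v i| ^ 3 / η ^ 2 * thirdMoment := by gcongr
      _ = thirdMoment / η ^ 3 * |v i| ^ 3 := by field_simp
  -- As `s² - τ² = (v i)²`, one has `1/τ - 1/s = (v i)² / (τ s (s + τ))`, at most `(v i)² / η³`.
  have hb2 : |2 / Real.pi * (v i / τ) - 2 / Real.pi * (v i / s)| ≤ 1 / η ^ 3 * |v i| ^ 3 := by
    have e : 2 / Real.pi * (v i / τ) - 2 / Real.pi * (v i / s)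
        = 2 / Real.pi * v i * ((s - τ) / (τ * s)) := by
      field_simp
    have h0 : 0 ≤ (s - τ) / (τ * s) := div_nonneg (by linarith) (by positivity)
    rw [e, abs_mul, abs_mul, abs_of_nonneg h0, abs_of_pos (by positivity : 0 < 2 / Real.pi)]
    have hk : (s - τ) / (τ * s) ≤ v i ^ 2 / η ^ 3 := by
      rw [div_le_div_iff₀ (by positivity) (by positivity)]
      have h1 : v i ^ 2 = (s - τ) * (s + τ) := by nlinarith
      rw [h1, mul_assoc]
      refine mul_le_mul_of_nonneg_left ?_ (by linarith)
      have h2 : η ^ 2 ≤ τ * s := by nlinarith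
      nlinarith
    have hpi : 2 / Real.pi ≤ 1 := by rw [div_le_one hp]; linarith [Real.pi_gt_three]
    calc 2 / Real.pi * |v i| * ((s - τ) / (τ * s)) ≤ 1 * |v i| * (v i ^ 2 / η ^ 3) := by gcongr
      _ = 1 / η ^ 3 * |v i| ^ 3 := by rw [← sq_abs (v i)]; ring
  rw [hlin] at hmain
  calc |meanSign η v i - 2 / Real.pi * (v i / s)|
      ≤ |meanSign η v i - 2 / Real.pi * (v i / τ)|
        + |2 / Real.pi * (v i / τ) - 2 / Real.pi * (v i / s)| := abs_sub_le _ _ _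
    _ ≤ thirdMoment / η ^ 3 * |v i| ^ 3 + 1 / η ^ 3 * |v i| ^ 3 := by linarith
    _ = (thirdMoment + 1) / η ^ 3 * |v i| ^ 3 := by ring

/-- The isometry of `ℝ^d` flipping the sign of one coordinate. -/
noncomputable def flipCoord (i : Fin d) : Vec d ≃ₗᵢ[ℝ] Vec d :=
  LinearIsometryEquiv.piLpCongrRight 2 fun j =>
    if j = i then LinearIsometryEquiv.neg ℝ else LinearIsometryEquiv.refl ℝ ℝ

lemma flipCoord_self (i : Fin d) (x : Vec d) : flipCoord i x i = -x i := by
  simp [flipCoord]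

lemma flipCoord_of_ne {i j : Fin d} (h : j ≠ i) (x : Vec d) : flipCoord i x j = x j := by
  simp [flipCoord, h]

lemma measurable_realSign_coord (i : Fin d) : Measurable fun x : Vec d => Real.sign (x i) :=
  measurable_realSign.comp (by fun_prop)

/-- Flipping coordinate `i` preserves the standard Gaussian and reverses the integrand. -/
lemma integral_realSign_mul_realSign {i j : Fin d} (h : j ≠ i) :
    ∫ x : Vec d, Real.sign (x i) * Real.sign (x j) ∂stdGaussian (Vec d) = 0 := by
  have hm : Measurable fun x : Vec d => Real.sign (x i) * Real.sign (x j) :=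
    (measurable_realSign_coord i).mul (measurable_realSign_coord j)
  have h1 : ∫ x : Vec d, Real.sign (x i) * Real.sign (x j) ∂stdGaussian (Vec d)
      = - ∫ x : Vec d, Real.sign (x i) * Real.sign (x j) ∂stdGaussian (Vec d) := by
    conv_lhs => rw [← stdGaussian_map (flipCoord i)]
    rw [integral_map (by fun_prop) hm.aestronglyMeasurable, ← integral_neg]
    refine integral_congr_ae (ae_of_all _ fun x => ?_)
    show Real.sign (flipCoord i x i) * Real.sign (flipCoord i x j) = _
    rw [flipCoord_self, flipCoord_of_ne h, Real.sign_neg]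
    ring
  linarith

lemma integrable_realSign_mul_realSign (i j : Fin d) :
    Integrable (fun x : Vec d => Real.sign (x i) * Real.sign (x j)) (stdGaussian (Vec d)) := by
  refine Integrable.of_bound ((measurable_realSign_coord i).mul
    (measurable_realSign_coord j)).aestronglyMeasurable 1 (ae_of_all _ fun p => ?_)
  rw [norm_mul]
  exact mul_le_one₀ (abs_realSign_le_one _) (abs_nonneg _) (abs_realSign_le_one _)

lemma inner_signStep (v : Vec d) (z : Vec d × ℝ) :
    inner ℝ v (signStep v z)
      = Real.sign (inner ℝ z.1 v - z.2) * ∑ i, v i * Real.sign (z.1 i) := by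
  rw [PiLp.inner_apply, Finset.mul_sum]
  refine Finset.sum_congr rfl fun i _ => ?_
  rw [signStep_apply]
  simp
  ring

/-- The sign of the residual is a factor common to all coordinates, so it disappears on squaring
although it depends on the whole of `x`. -/
lemma sq_inner_signStep_le (v : Vec d) (z : Vec d × ℝ) :
    inner ℝ v (signStep v z) ^ 2 ≤ (∑ i, v i * Real.sign (z.1 i)) ^ 2 := by
  rw [inner_signStep, mul_pow]
  exact mul_le_of_le_one_left (sq_nonneg _) (realSign_sq_le_one _)

/-- The projection of the sign step on the error vector has second moment `‖v‖²`, with no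
dimension factor. -/
lemma integral_sq_inner_signStep_le (η : ℝ) (v : Vec d) :
    ∫ z, inner ℝ v (signStep v z) ^ 2 ∂sampleLaw d η ≤ ‖v‖ ^ 2 := by
  have hexp : ∀ x : Vec d, (∑ i, v i * Real.sign (x i)) ^ 2
      = ∑ i, ∑ j, v i * v j * (Real.sign (x i) * Real.sign (x j)) := fun x => by
    rw [sq, Finset.sum_mul_sum]
    exact Finset.sum_congr rfl fun i _ => Finset.sum_congr rfl fun j _ => by ring
  have hint : Integrable (fun x : Vec d => (∑ i, v i * Real.sign (x i)) ^ 2)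
      (stdGaussian (Vec d)) := by
    simp_rw [hexp]
    exact integrable_finsetSum _ fun i _ => integrable_finsetSum _ fun j _ =>
      (integrable_realSign_mul_realSign i j).const_mul _
  calc ∫ z, inner ℝ v (signStep v z) ^ 2 ∂sampleLaw d η
      ≤ ∫ z : Vec d × ℝ, (∑ i, v i * Real.sign (z.1 i)) ^ 2 ∂sampleLaw d η :=
        integral_mono_of_nonneg (ae_of_all _ fun z => sq_nonneg _) (hint.comp_fst _)
          (ae_of_all _ fun z => sq_inner_signStep_le v z)
    _ = ∫ x : Vec d, (∑ i, v i * Real.sign (x i)) ^ 2 ∂stdGaussian (Vec d) := by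
        rw [integral_fun_fst (f := fun x : Vec d => (∑ i, v i * Real.sign (x i)) ^ 2)]
        simp
    _ = ∑ i, ∑ j, v i * v j * ∫ x : Vec d, Real.sign (x i) * Real.sign (x j)
          ∂stdGaussian (Vec d) := by
        simp_rw [hexp]
        rw [integral_finsetSum _ fun i _ => integrable_finsetSum _ fun j _ =>
          (integrable_realSign_mul_realSign i j).const_mul _]
        refine Finset.sum_congr rfl fun i _ => ?_
        rw [integral_finsetSum _ fun j _ => (integrable_realSign_mul_realSign i j).const_mul _]
        exact Finset.sum_congr rfl fun j _ => integral_const_mul _ _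
    _ = ∑ i, v i * v i * ∫ x : Vec d, Real.sign (x i) * Real.sign (x i)
          ∂stdGaussian (Vec d) := by
        refine Finset.sum_congr rfl fun i _ => Finset.sum_eq_single i (fun j _ hj => ?_) (by simp)
        rw [integral_realSign_mul_realSign hj, mul_zero]
    _ ≤ ∑ i, v i ^ 2 := by
        refine Finset.sum_le_sum fun i _ => ?_
        have h1 : ∫ x : Vec d, Real.sign (x i) * Real.sign (x i) ∂stdGaussian (Vec d)
            ≤ ∫ _x : Vec d, (1 : ℝ) ∂stdGaussian (Vec d) :=
          integral_mono (integrable_realSign_mul_realSign i i) (integrable_const _) fun x => by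
            show Real.sign (x i) * Real.sign (x i) ≤ 1
            rw [← sq]; exact realSign_sq_le_one _
        simp only [integral_const, probReal_univ, smul_eq_mul, mul_one] at h1
        nlinarith [mul_self_nonneg (v i)]
    _ = ‖v‖ ^ 2 := (EuclideanSpace.real_norm_sq_eq v).symm

end Step

/-! ### Drift and centered increment of the risk. -/

section Drift

variable {d : ℕ}

/-- The mean of `⟨v, signStep v z⟩`. -/
noncomputable def drift (η : ℝ) (v : Vec d) : ℝ := ∑ i, v i * meanSign η v i

/-- The bound `√d` is also available; the cruder `d` suffices because it serves only for
integrability. -/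
lemma norm_signStep_le (v : Vec d) (z : Vec d × ℝ) : ‖signStep v z‖ ≤ d := by
  have h := norm_signStep_sq_le v z
  rcases Nat.eq_zero_or_pos d with h0 | h0
  · subst h0
    have : ‖signStep v z‖ ^ 2 ≤ 0 := by simpa using h
    nlinarith [norm_nonneg (signStep v z), Nat.cast_nonneg (α := ℝ) 0]
  · have h1 : (1 : ℝ) ≤ d := by exact_mod_cast h0
    nlinarith [norm_nonneg (signStep v z)]

lemma abs_inner_signStep_le (v : Vec d) (z : Vec d × ℝ) : |inner ℝ v (signStep v z)| ≤ ‖v‖ * d :=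
  (abs_real_inner_le_norm _ _).trans
    (mul_le_mul_of_nonneg_left (norm_signStep_le v z) (norm_nonneg _))

lemma inner_signStep_eq_sum (v : Vec d) (z : Vec d × ℝ) :
    inner ℝ v (signStep v z) = ∑ i, v i * signStep v z i := by
  rw [PiLp.inner_apply]
  exact Finset.sum_congr rfl fun i _ => by simp [mul_comm]

lemma measurable_inner_signStep :
    Measurable fun p : Vec d × (Vec d × ℝ) => (inner ℝ p.1 (signStep p.1 p.2) : ℝ) := by
  simp_rw [inner_signStep_eq_sum]
  exact Finset.measurable_fun_sum _ fun i _ =>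
    Measurable.mul (by fun_prop) (measurable_signStep_apply i)

lemma integrable_inner_signStep (η : ℝ) (v : Vec d) :
    Integrable (fun z => (inner ℝ v (signStep v z) : ℝ)) (sampleLaw d η) := by
  simp_rw [inner_signStep_eq_sum]
  exact integrable_finsetSum _ fun i _ => (integrable_signStep_apply η v i).const_mul _

lemma integral_inner_signStep (η : ℝ) (v : Vec d) :
    ∫ z, inner ℝ v (signStep v z) ∂sampleLaw d η = drift η v := by
  simp_rw [inner_signStep_eq_sum]
  rw [integral_finsetSum _ fun i _ => (integrable_signStep_apply η v i).const_mul _]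
  exact Finset.sum_congr rfl fun i _ => integral_const_mul _ _

lemma measurable_meanSign (η : ℝ) (i : Fin d) : Measurable fun v : Vec d => meanSign η v i :=
  ((measurable_signStep_apply i).stronglyMeasurable.integral_prod_right
    (ν := sampleLaw d η)).measurable

lemma measurable_drift (η : ℝ) : Measurable fun v : Vec d => drift η v :=
  Finset.measurable_fun_sum _ fun i _ => Measurable.mul (by fun_prop) (measurable_meanSign η i)

lemma abs_drift_le (η : ℝ) (v : Vec d) : |drift η v| ≤ ‖v‖ * d := by
  rw [← integral_inner_signStep]
  have := norm_integral_le_of_norm_le_const (μ := sampleLaw d η)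
    (f := fun z => (inner ℝ v (signStep v z) : ℝ)) (C := ‖v‖ * d)
    (ae_of_all _ fun z => abs_inner_signStep_le v z)
  simpa using this

/-- The fourth power of the `ℓ⁴` norm. -/
noncomputable def quartic (v : Vec d) : ℝ := ∑ i, v i ^ 4

lemma quartic_nonneg (v : Vec d) : 0 ≤ quartic v :=
  Finset.sum_nonneg fun i _ => by positivity

lemma measurable_quartic : Measurable (quartic : Vec d → ℝ) :=
  Finset.measurable_fun_sum _ fun i _ => by fun_prop

lemma quartic_le (v : Vec d) : quartic v ≤ d * ‖v‖ ^ 4 := by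
  calc quartic v ≤ ∑ _i : Fin d, ‖v‖ ^ 4 := Finset.sum_le_sum fun i _ => by
        have := sq_apply_le_norm_sq v i
        nlinarith [sq_nonneg (v i), sq_nonneg ‖v‖]
    _ = d * ‖v‖ ^ 4 := by simp

/-- The constant of the cubic error in the linearisation of the mean sign step. -/
noncomputable def cubicConst (η : ℝ) : ℝ := (thirdMoment + 1) / η ^ 3

lemma cubicConst_nonneg {η : ℝ} (hη : 0 < η) : 0 ≤ cubicConst η :=
  div_nonneg (by linarith [thirdMoment_nonneg]) (by positivity)

/-- Weighting by `v i` turns the cubic error of each coordinate into `(v i)⁴`, while the linear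
parts add up to `‖v‖²`. -/
lemma abs_drift_sub_le {η : ℝ} (hη : 0 < η) (v : Vec d) :
    |drift η v - 2 / Real.pi * (‖v‖ ^ 2 / Real.sqrt (‖v‖ ^ 2 + η ^ 2))|
      ≤ cubicConst η * quartic v := by
  have e : drift η v - 2 / Real.pi * (‖v‖ ^ 2 / Real.sqrt (‖v‖ ^ 2 + η ^ 2))
      = ∑ i, v i * (meanSign η v i - 2 / Real.pi * (v i / Real.sqrt (‖v‖ ^ 2 + η ^ 2))) := by
    simp_rw [mul_sub]
    rw [Finset.sum_sub_distrib, drift]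
    congr 1
    rw [EuclideanSpace.real_norm_sq_eq v, Finset.sum_div, Finset.mul_sum]
    refine Finset.sum_congr rfl fun i _ => ?_
    ring
  rw [e, quartic, Finset.mul_sum]
  refine (Finset.abs_sum_le_sum_abs _ _).trans (Finset.sum_le_sum fun i _ => ?_)
  rw [abs_mul]
  calc |v i| * |meanSign η v i - 2 / Real.pi * (v i / Real.sqrt (‖v‖ ^ 2 + η ^ 2))|
      ≤ |v i| * (cubicConst η * |v i| ^ 3) :=
        mul_le_mul_of_nonneg_left (abs_meanSign_sub_le hη v i) (abs_nonneg _)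
    _ = cubicConst η * |v i| ^ 4 := by ring
    _ = cubicConst η * v i ^ 4 := by rw [Even.pow_abs (by decide)]

lemma integral_sq_inner_signStep_sub_drift_le (η : ℝ) (v : Vec d) :
    ∫ z, (inner ℝ v (signStep v z) - drift η v) ^ 2 ∂sampleLaw d η ≤ ‖v‖ ^ 2 := by
  have hsq : Integrable (fun z => (inner ℝ v (signStep v z) : ℝ) ^ 2) (sampleLaw d η) := by
    refine Integrable.of_bound
      ((integrable_inner_signStep η v).aestronglyMeasurable.pow 2) ((‖v‖ * d) ^ 2)
      (ae_of_all _ fun z => ?_)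
    rw [norm_pow]
    exact pow_le_pow_left₀ (norm_nonneg _) (abs_inner_signStep_le v z) 2
  have hi := integrable_inner_signStep η v
  have e : ∫ z, (inner ℝ v (signStep v z) - drift η v) ^ 2 ∂sampleLaw d η
      = ∫ z, inner ℝ v (signStep v z) ^ 2 ∂sampleLaw d η - drift η v ^ 2 := by
    have : ∀ z : Vec d × ℝ, (inner ℝ v (signStep v z) - drift η v) ^ 2
        = inner ℝ v (signStep v z) ^ 2 - 2 * drift η v * inner ℝ v (signStep v z)
          + drift η v ^ 2 := fun z => by ring
    simp_rw [this]
    have hs : Integrable (fun z => inner ℝ v (signStep v z) ^ 2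
        - 2 * drift η v * inner ℝ v (signStep v z)) (sampleLaw d η) := hsq.sub (hi.const_mul _)
    rw [integral_add hs (integrable_const _), integral_sub hsq (hi.const_mul _),
      integral_const_mul, integral_inner_signStep]
    simp
    ring
  rw [e]
  linarith [integral_sq_inner_signStep_le η v, sq_nonneg (drift η v)]

/-- The centered one-step change of the risk, up to sign. -/
noncomputable def centeredStep (η : ℝ) (p : Vec d × (Vec d × ℝ)) : ℝ :=
  η / d * (inner ℝ p.1 (signStep p.1 p.2) - drift η p.1)

lemma measurable_centeredStep (η : ℝ) :
    Measurable (centeredStep η : Vec d × (Vec d × ℝ) → ℝ) := by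
  refine Measurable.const_mul (Measurable.sub measurable_inner_signStep ?_) _
  exact (measurable_drift η).comp measurable_fst

lemma integral_centeredStep (η : ℝ) (v : Vec d) :
    ∫ z, centeredStep η (v, z) ∂sampleLaw d η = 0 := by
  simp only [centeredStep]
  rw [integral_const_mul, integral_sub (integrable_inner_signStep η _) (integrable_const _),
    integral_inner_signStep]
  simp

lemma integral_centeredStep_sq_le (η : ℝ) (v : Vec d) :
    ∫ z, centeredStep η (v, z) ^ 2 ∂sampleLaw d η ≤ (η / d) ^ 2 * ‖v‖ ^ 2 := by
  simp only [centeredStep, mul_pow]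
  rw [integral_const_mul]
  exact mul_le_mul_of_nonneg_left (integral_sq_inner_signStep_sub_drift_le η _) (sq_nonneg _)

end Drift

/-! ### The random walk of error vectors: moments and maximal inequality. -/

section Walk

variable {d : ℕ} {Ω : Type*} [m : MeasurableSpace Ω] {P : Measure Ω}

/-- The error vector of signSGD as a process driven by fresh samples `Z k`, each independent of
the past `𝒢 k`. -/
structure SignWalk (P : Measure Ω) (η : ℝ) (𝒢 : Filtration ℕ m) (V : ℕ → Ω → Vec d)
    (Z : ℕ → Ω → Vec d × ℝ) : Prop where
  pos : 0 < η
  adapted : ∀ k, Measurable[𝒢 k] (V k)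
  measurable_sample : ∀ k, Measurable (Z k)
  law : ∀ k, P.map (Z k) = sampleLaw d η
  indep : ∀ k, Indep (𝒢 k) (MeasurableSpace.comap (Z k) inferInstance) P
  step : ∀ k ω, V (k + 1) ω = V k ω - (η / d) • signStep (V k ω) (Z k ω)
  init : ∀ᵐ ω ∂P, ‖V 0 ω‖ ≤ 2

namespace SignWalk

variable {η : ℝ} {𝒢 : Filtration ℕ m} {V : ℕ → Ω → Vec d}
  {Z : ℕ → Ω → Vec d × ℝ}

lemma measurable (W : SignWalk P η 𝒢 V Z) (k : ℕ) : Measurable (V k) :=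
  (W.adapted k).mono (𝒢.le k) le_rfl

lemma div_mul_le (W : SignWalk P η 𝒢 V Z) : η / d * d ≤ η := by
  rcases Nat.eq_zero_or_pos d with h0 | h0
  · subst h0; simp [W.pos.le]
  · rw [div_mul_cancel₀]; positivity

lemma div_nonneg (W : SignWalk P η 𝒢 V Z) : 0 ≤ η / d :=
  _root_.div_nonneg W.pos.le (Nat.cast_nonneg d)

/-- The martingale increment of the risk. -/
noncomputable def noise (η : ℝ) (V : ℕ → Ω → Vec d) (Z : ℕ → Ω → Vec d × ℝ) (k : ℕ) (ω : Ω) : ℝ :=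
  centeredStep η (V k ω, Z k ω)

/-- The martingale part of the risk. -/
noncomputable def noiseSum (η : ℝ) (V : ℕ → Ω → Vec d) (Z : ℕ → Ω → Vec d × ℝ) (n : ℕ) (ω : Ω) :
    ℝ := ∑ k ∈ Finset.range n, noise η V Z k ω

lemma measurable_noise (W : SignWalk P η 𝒢 V Z) (k : ℕ) :
    Measurable[𝒢 (k + 1)] (noise η V Z k) := by
  -- The sample is not assumed measurable for the filtration, so the step is recovered from two
  -- consecutive positions of the walk.
  have e : noise η V Z k
      = fun ω => inner ℝ (V k ω) (V k ω - V (k + 1) ω) - η / d * drift η (V k ω) := by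
    funext ω
    rw [noise, centeredStep, W.step, sub_sub_cancel, inner_smul_right]
    ring
  have h1 : Measurable[𝒢 (k + 1)] (V k) := (W.adapted k).mono (𝒢.mono (Nat.le_succ k)) le_rfl
  rw [e]
  exact (Measurable.inner h1 (h1.sub (W.adapted (k + 1)))).sub
    (((measurable_drift η).comp h1).const_mul _)

lemma measurable_noiseSum (W : SignWalk P η 𝒢 V Z) (n : ℕ) :
    Measurable[𝒢 n] (noiseSum η V Z n) :=
  Finset.measurable_fun_sum _ fun k hk =>
    (W.measurable_noise k).mono (𝒢.mono (Finset.mem_range.1 hk)) le_rfl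

/-- A bound growing with `k`, used only for integrability; the quantitative estimates rest on second
moments. -/
lemma ae_norm_le (W : SignWalk P η 𝒢 V Z) (k : ℕ) : ∀ᵐ ω ∂P, ‖V k ω‖ ≤ 2 + k * η := by
  filter_upwards [W.init] with ω h0
  induction k with
  | zero => simpa using h0
  | succ k ih =>
    rw [W.step]
    have h := norm_sub_le (V k ω) ((η / d) • signStep (V k ω) (Z k ω))
    rw [norm_smul, Real.norm_of_nonneg W.div_nonneg] at h
    have h1 := mul_le_mul_of_nonneg_left (norm_signStep_le (V k ω) (Z k ω)) W.div_nonneg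
    have := W.div_mul_le
    push_cast
    linarith

lemma ae_abs_noise_le (W : SignWalk P η 𝒢 V Z) (k : ℕ) :
    ∀ᵐ ω ∂P, |noise η V Z k ω| ≤ 2 * η * (2 + k * η) := by
  filter_upwards [W.ae_norm_le k] with ω h
  rw [noise, centeredStep, abs_mul, abs_of_nonneg W.div_nonneg]
  have h1 := (abs_sub _ _).trans (add_le_add (abs_inner_signStep_le (V k ω) (Z k ω))
    (abs_drift_le η (V k ω)))
  calc η / d * |inner ℝ (V k ω) (signStep (V k ω) (Z k ω)) - drift η (V k ω)|
      ≤ η / d * (‖V k ω‖ * d + ‖V k ω‖ * d) := mul_le_mul_of_nonneg_left h1 W.div_nonneg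
    _ = 2 * (η / d * d) * ‖V k ω‖ := by ring
    _ ≤ 2 * η * (2 + k * η) := by
        have := W.div_mul_le
        have := W.pos
        gcongr

lemma exists_ae_abs_noiseSum_le (W : SignWalk P η 𝒢 V Z) (n : ℕ) :
    ∃ C, ∀ᵐ ω ∂P, |noiseSum η V Z n ω| ≤ C := by
  refine ⟨∑ k ∈ Finset.range n, 2 * η * (2 + k * η), ?_⟩
  have : ∀ᵐ ω ∂P, ∀ k, |noise η V Z k ω| ≤ 2 * η * (2 + k * η) :=
    ae_all_iff.2 W.ae_abs_noise_le
  filter_upwards [this] with ω h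
  exact (Finset.abs_sum_le_sum_abs _ _).trans (Finset.sum_le_sum fun k _ => h k)

variable [IsProbabilityMeasure P]

lemma map_prodMk {E : Type*} [MeasurableSpace E] (W : SignWalk P η 𝒢 V Z) {k : ℕ} {U : Ω → E}
    (hU : Measurable[𝒢 k] U) :
    P.map (fun ω => (U ω, Z k ω)) = (P.map U).prod (sampleLaw d η) := by
  have hU' : Measurable U := hU.mono (𝒢.le k) le_rfl
  have hind : IndepFun U (Z k) P := by
    rw [IndepFun_iff_Indep]
    exact indep_of_indep_of_le_left (W.indep k) hU.comap_le
  rw [(indepFun_iff_map_prod_eq_prod_map_map hU'.aemeasurable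
    (W.measurable_sample k).aemeasurable).1 hind, W.law]

/-- Freezing of the past: this plays the role of a conditional expectation. The variable `U` is
arbitrary so that it can later carry the martingale and an event of the past along with `V k`. -/
lemma integral_comp {E : Type*} [MeasurableSpace E] (W : SignWalk P η 𝒢 V Z) {k : ℕ} {U : Ω → E}
    (hU : Measurable[𝒢 k] U) {F : E × (Vec d × ℝ) → ℝ} (hF : Measurable F)
    (hint : Integrable (fun ω => F (U ω, Z k ω)) P) :
    ∫ ω, F (U ω, Z k ω) ∂P = ∫ ω, ∫ z, F (U ω, z) ∂sampleLaw d η ∂P := by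
  have hU' : Measurable U := hU.mono (𝒢.le k) le_rfl
  have hp : Measurable fun ω => (U ω, Z k ω) := hU'.prodMk (W.measurable_sample k)
  have : IsProbabilityMeasure (P.map U) := Measure.isProbabilityMeasure_map hU'.aemeasurable
  have hint' : Integrable F ((P.map U).prod (sampleLaw d η)) := by
    rw [← W.map_prodMk hU, integrable_map_measure hF.aestronglyMeasurable hp.aemeasurable]
    exact hint
  rw [← integral_map (f := F) hp.aemeasurable hF.aestronglyMeasurable, W.map_prodMk hU,
    integral_prod _ hint', integral_map hU'.aemeasurable]
  exact (hF.stronglyMeasurable.integral_prod_right' (ν := sampleLaw d η)).aestronglyMeasurable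

lemma ae_signStep_sq (W : SignWalk P η 𝒢 V Z) (k : ℕ) :
    ∀ᵐ ω ∂P, ∀ i, signStep (V k ω) (Z k ω) i ^ 2 = 1 := by
  have hp : Measurable fun ω => (V k ω, Z k ω) := (W.measurable k).prodMk (W.measurable_sample k)
  refine ae_of_ae_map (p := fun p : Vec d × (Vec d × ℝ) => ∀ i, signStep p.1 p.2 i ^ 2 = 1)
    hp.aemeasurable ?_
  have : IsProbabilityMeasure (P.map (V k)) :=
    Measure.isProbabilityMeasure_map (W.measurable k).aemeasurable
  rw [W.map_prodMk (W.adapted k), Measure.ae_prod_iff_ae_ae]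
  · exact ae_of_all _ fun v => ae_signStep_sq_eq_one W.pos v
  · simp only [Set.ofPred_forall]
    exact MeasurableSet.iInter fun i =>
      measurableSet_eq_fun ((measurable_signStep_apply i).pow_const 2) measurable_const

lemma integrable_pow_mul_signStep (W : SignWalk P η 𝒢 V Z) (k n : ℕ) (i : Fin d) :
    Integrable (fun ω => V k ω i ^ n * signStep (V k ω) (Z k ω) i) P := by
  refine Integrable.of_bound (C := (2 + k * η) ^ n) ?_ ?_
  · exact (Measurable.mul ((by fun_prop : Measurable fun v : Vec d => v i ^ n).comp
      (W.measurable k)) ((measurable_signStep_apply i).comp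
        ((W.measurable k).prodMk (W.measurable_sample k)))).aestronglyMeasurable
  · filter_upwards [W.ae_norm_le k] with ω h
    rw [norm_mul, norm_pow]
    calc ‖V k ω i‖ ^ n * ‖signStep (V k ω) (Z k ω) i‖ ≤ ‖V k ω i‖ ^ n * 1 :=
          mul_le_mul_of_nonneg_left (abs_signStep_le_one _ _ _) (by positivity)
      _ ≤ (2 + k * η) ^ n := by
          rw [mul_one]
          exact pow_le_pow_left₀ (norm_nonneg _) ((PiLp.norm_apply_le _ i).trans h) n

/-- After averaging over the fresh sample, the integrand is an even power of the coordinate times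
the nonnegative quantity of `meanSign_mul_nonneg`. -/
lemma integral_pow_mul_signStep_nonneg (W : SignWalk P η 𝒢 V Z) (k n : ℕ) (i : Fin d) :
    0 ≤ ∫ ω, V k ω i ^ (2 * n + 1) * signStep (V k ω) (Z k ω) i ∂P := by
  have h := W.integral_comp (W.adapted k)
    (F := fun p => p.1 i ^ (2 * n + 1) * signStep p.1 p.2 i)
    (Measurable.mul (by fun_prop) (measurable_signStep_apply i))
    (W.integrable_pow_mul_signStep k _ i)
  simp only at h
  rw [h]
  refine integral_nonneg fun ω => ?_
  show 0 ≤ ∫ z, V k ω i ^ (2 * n + 1) * signStep (V k ω) z i ∂sampleLaw d η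
  rw [integral_const_mul]
  have := meanSign_mul_nonneg W.pos (V k ω) i
  have e : V k ω i ^ (2 * n + 1) * ∫ z, signStep (V k ω) z i ∂sampleLaw d η
      = (V k ω i ^ n) ^ 2 * (V k ω i * meanSign η (V k ω) i) := by
    rw [meanSign]; ring
  rw [e]
  positivity

lemma integrable_norm_sq (W : SignWalk P η 𝒢 V Z) (k : ℕ) :
    Integrable (fun ω => ‖V k ω‖ ^ 2) P := by
  refine Integrable.of_bound (C := (2 + k * η) ^ 2)
    ((W.measurable k).norm.pow_const 2).aestronglyMeasurable ?_
  filter_upwards [W.ae_norm_le k] with ω h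
  rw [norm_pow, norm_norm]
  exact pow_le_pow_left₀ (norm_nonneg _) h 2

lemma integrable_quartic (W : SignWalk P η 𝒢 V Z) (k : ℕ) :
    Integrable (fun ω => quartic (V k ω)) P := by
  refine Integrable.of_bound (C := d * (2 + k * η) ^ 4)
    (measurable_quartic.comp (W.measurable k)).aestronglyMeasurable ?_
  filter_upwards [W.ae_norm_le k] with ω h
  rw [Real.norm_of_nonneg (quartic_nonneg _)]
  refine (quartic_le _).trans ?_
  gcongr

/-- The cross term has a favourable sign in mean and is dropped; only `‖s‖² ≤ d` contributes. -/
lemma integral_norm_sq_succ_le (W : SignWalk P η 𝒢 V Z) (k : ℕ) :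
    ∫ ω, ‖V (k + 1) ω‖ ^ 2 ∂P ≤ ∫ ω, ‖V k ω‖ ^ 2 ∂P + (η / d) ^ 2 * d := by
  have hS : ∀ i : Fin d, Integrable (fun ω => V k ω i * signStep (V k ω) (Z k ω) i) P :=
    fun i => by simpa using W.integrable_pow_mul_signStep k 1 i
  have hSum : Integrable (fun ω => ∑ i, V k ω i * signStep (V k ω) (Z k ω) i) P :=
    integrable_finsetSum _ fun i _ => hS i
  have h0 : 0 ≤ ∫ ω, ∑ i, V k ω i * signStep (V k ω) (Z k ω) i ∂P := by
    rw [integral_finsetSum _ fun i _ => hS i]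
    exact Finset.sum_nonneg fun i _ => by
      simpa using W.integral_pow_mul_signStep_nonneg k 0 i
  calc ∫ ω, ‖V (k + 1) ω‖ ^ 2 ∂P
      ≤ ∫ ω, (‖V k ω‖ ^ 2 + (η / d) ^ 2 * d
          - 2 * (η / d) * ∑ i, V k ω i * signStep (V k ω) (Z k ω) i) ∂P := by
        refine integral_mono (W.integrable_norm_sq _)
          (((W.integrable_norm_sq k).add (integrable_const _)).sub (hSum.const_mul _)) fun ω => ?_
        show ‖V (k + 1) ω‖ ^ 2 ≤ _
        rw [W.step, norm_sub_sq_real, inner_smul_right, inner_signStep_eq_sum, norm_smul, mul_pow,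
          Real.norm_eq_abs, sq_abs]
        have := mul_le_mul_of_nonneg_left (norm_signStep_sq_le (V k ω) (Z k ω))
          (sq_nonneg (η / d))
        linarith
    _ = ∫ ω, ‖V k ω‖ ^ 2 ∂P + (η / d) ^ 2 * d
          - 2 * (η / d) * ∫ ω, ∑ i, V k ω i * signStep (V k ω) (Z k ω) i ∂P := by
        have hI : Integrable (fun ω => ‖V k ω‖ ^ 2 + (η / d) ^ 2 * d) P :=
          (W.integrable_norm_sq k).add (integrable_const _)
        rw [integral_sub hI (hSum.const_mul _),
          integral_add (W.integrable_norm_sq k) (integrable_const _),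
          integral_const_mul (2 * (η / d))]
        simp
    _ ≤ _ := by
        have := mul_nonneg (mul_nonneg zero_le_two W.div_nonneg) h0
        linarith

/-- In the expansion of `(a - δ s)⁴` the terms odd in `s` become `a³ s` and `a s`, by `s³ = s`, and
both lower the mean. What remains is `O(1/d²)` when the second moment is bounded, hence `O(1/d)`
over `T d` steps. -/
lemma integral_quartic_succ_le (W : SignWalk P η 𝒢 V Z) (k : ℕ) :
    ∫ ω, quartic (V (k + 1) ω) ∂P ≤ ∫ ω, quartic (V k ω) ∂P
      + 6 * (η / d) ^ 2 * ∫ ω, ‖V k ω‖ ^ 2 ∂P + (η / d) ^ 4 * d := by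
  set δ := η / d with hδ
  have hδ0 : 0 ≤ δ := W.div_nonneg
  -- `D` collects the odd terms. The exponent `1` is kept explicit to match
  -- `integrable_pow_mul_signStep`.
  let D : Ω → ℝ := fun ω => ∑ i, (4 * δ * (V k ω i ^ 3 * signStep (V k ω) (Z k ω) i)
    + 4 * δ ^ 3 * (V k ω i ^ 1 * signStep (V k ω) (Z k ω) i))
  have hDi : ∀ i, Integrable (fun ω => 4 * δ * (V k ω i ^ 3 * signStep (V k ω) (Z k ω) i)
    + 4 * δ ^ 3 * (V k ω i ^ 1 * signStep (V k ω) (Z k ω) i)) P := fun i =>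
    ((W.integrable_pow_mul_signStep k 3 i).const_mul _).add
      ((W.integrable_pow_mul_signStep k 1 i).const_mul _)
  have hD : Integrable D P := integrable_finsetSum _ fun i _ => hDi i
  have h0 : 0 ≤ ∫ ω, D ω ∂P := by
    rw [integral_finsetSum _ fun i _ => hDi i]
    refine Finset.sum_nonneg fun i _ => ?_
    rw [integral_add ((W.integrable_pow_mul_signStep k 3 i).const_mul _)
      ((W.integrable_pow_mul_signStep k 1 i).const_mul _), integral_const_mul, integral_const_mul]
    have h3 := W.integral_pow_mul_signStep_nonneg k 1 i
    have h1 := W.integral_pow_mul_signStep_nonneg k 0 i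
    norm_num at h3 h1
    norm_num
    positivity
  have hI0 : Integrable (fun ω => quartic (V k ω) + 6 * δ ^ 2 * ‖V k ω‖ ^ 2) P :=
    (W.integrable_quartic k).add ((W.integrable_norm_sq k).const_mul (6 * δ ^ 2))
  have hI : Integrable (fun ω => quartic (V k ω) + 6 * δ ^ 2 * ‖V k ω‖ ^ 2 + δ ^ 4 * d) P :=
    hI0.add (integrable_const _)
  calc ∫ ω, quartic (V (k + 1) ω) ∂P
      ≤ ∫ ω, (quartic (V k ω) + 6 * δ ^ 2 * ‖V k ω‖ ^ 2 + δ ^ 4 * d - D ω) ∂P := by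
        refine integral_mono (W.integrable_quartic _) (hI.sub hD) fun ω => ?_
        show quartic (V (k + 1) ω) ≤ _
        rw [W.step, quartic, quartic, EuclideanSpace.real_norm_sq_eq, Finset.mul_sum,
          show δ ^ 4 * (d : ℝ) = ∑ _i : Fin d, δ ^ 4 by simp [mul_comm],
          ← Finset.sum_add_distrib, ← Finset.sum_add_distrib, ← Finset.sum_sub_distrib]
        refine Finset.sum_le_sum fun i _ => ?_
        simp only [PiLp.sub_apply, PiLp.smul_apply, smul_eq_mul]
        have hs2 := signStep_sq_le_one (V k ω) (Z k ω) i
        have hs3 := signStep_pow_three (V k ω) (Z k ω) i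
        set a := V k ω i
        set s := signStep (V k ω) (Z k ω) i
        have e : (a - δ * s) ^ 4 = a ^ 4 - 4 * δ * (a ^ 3 * s) + 6 * δ ^ 2 * a ^ 2 * s ^ 2
            - 4 * δ ^ 3 * (a * s ^ 3) + δ ^ 4 * (s ^ 2) ^ 2 := by ring
        rw [← hδ, e, hs3]
        have h1 : 6 * δ ^ 2 * a ^ 2 * s ^ 2 ≤ 6 * δ ^ 2 * a ^ 2 :=
          mul_le_of_le_one_right (by positivity) hs2
        have h2 : δ ^ 4 * (s ^ 2) ^ 2 ≤ δ ^ 4 :=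
          mul_le_of_le_one_right (by positivity) (pow_le_one₀ (sq_nonneg _) hs2)
        rw [pow_one]
        linarith
    _ = ∫ ω, quartic (V k ω) ∂P + 6 * δ ^ 2 * ∫ ω, ‖V k ω‖ ^ 2 ∂P + δ ^ 4 * d - ∫ ω, D ω ∂P := by
        rw [integral_sub hI hD, integral_add hI0 (integrable_const _),
          integral_add (W.integrable_quartic k) ((W.integrable_norm_sq k).const_mul _),
          integral_const_mul]
        simp
    _ ≤ _ := by linarith

lemma integrable_noise_sq (W : SignWalk P η 𝒢 V Z) (k : ℕ) :
    Integrable (fun ω => noise η V Z k ω ^ 2) P := by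
  refine Integrable.of_bound (C := (2 * η * (2 + k * η)) ^ 2) ((((W.measurable_noise k).mono
    (𝒢.le _) le_rfl).pow_const 2).aestronglyMeasurable) ?_
  filter_upwards [W.ae_abs_noise_le k] with ω h
  rw [norm_pow]
  exact pow_le_pow_left₀ (norm_nonneg _) h 2

lemma integrable_noiseSum_sq (W : SignWalk P η 𝒢 V Z) (n : ℕ) :
    Integrable (fun ω => noiseSum η V Z n ω ^ 2) P := by
  obtain ⟨C, hC⟩ := W.exists_ae_abs_noiseSum_le n
  refine Integrable.of_bound (C := C ^ 2) ((((W.measurable_noiseSum n).mono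
    (𝒢.le _) le_rfl).pow_const 2).aestronglyMeasurable) ?_
  filter_upwards [hC] with ω h
  rw [norm_pow]
  exact pow_le_pow_left₀ (norm_nonneg _) h 2

lemma integrable_noiseSum_mul_noise (W : SignWalk P η 𝒢 V Z) (n : ℕ) :
    Integrable (fun ω => noiseSum η V Z n ω * noise η V Z n ω) P := by
  obtain ⟨C, hC⟩ := W.exists_ae_abs_noiseSum_le n
  refine Integrable.of_bound (C := C * (2 * η * (2 + n * η)))
    (((W.measurable_noiseSum n).mono (𝒢.le _) le_rfl).mul
      ((W.measurable_noise n).mono (𝒢.le _) le_rfl)).aestronglyMeasurable ?_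
  filter_upwards [hC, W.ae_abs_noise_le n] with ω h h'
  rw [norm_mul]
  exact mul_le_mul h h' (norm_nonneg _) ((abs_nonneg _).trans h)

/-- The indicator of a past event is absorbed into the past factor; the fresh increment then
integrates to zero. This orthogonality yields both the submartingale property and the additivity of
variances. -/
lemma setIntegral_noiseSum_mul_noise (W : SignWalk P η 𝒢 V Z) (n : ℕ) {s : Set Ω}
    (hs : MeasurableSet[𝒢 n] s) : ∫ ω in s, noiseSum η V Z n ω * noise η V Z n ω ∂P = 0 := by
  have hs' : MeasurableSet s := 𝒢.le n s hs
  rw [← integral_indicator hs']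
  have hU : Measurable[𝒢 n] fun ω => (s.indicator (noiseSum η V Z n) ω, V n ω) :=
    ((W.measurable_noiseSum n).indicator hs).prodMk (W.adapted n)
  let F : (ℝ × Vec d) × (Vec d × ℝ) → ℝ := fun p => p.1.1 * centeredStep η (p.1.2, p.2)
  have hF : Measurable F := by
    have := measurable_centeredStep (d := d) η
    fun_prop
  have e : (s.indicator fun ω => noiseSum η V Z n ω * noise η V Z n ω)
      = fun ω => F ((s.indicator (noiseSum η V Z n) ω, V n ω), Z n ω) := by
    funext ω
    by_cases h : ω ∈ s
    · rw [Set.indicator_of_mem h]; simp only [F, Set.indicator_of_mem h]; rfl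
    · rw [Set.indicator_of_notMem h]; simp only [F, Set.indicator_of_notMem h, zero_mul]
  have hint : Integrable (fun ω => F ((s.indicator (noiseSum η V Z n) ω, V n ω), Z n ω)) P := by
    rw [← e]
    exact (W.integrable_noiseSum_mul_noise n).indicator hs'
  rw [e]
  refine (W.integral_comp hU hF hint).trans (integral_eq_zero_of_ae (ae_of_all _ fun ω => ?_))
  simp only [F, integral_const_mul, integral_centeredStep, mul_zero, Pi.zero_apply]

lemma integral_noise_sq_le (W : SignWalk P η 𝒢 V Z) (k : ℕ) :
    ∫ ω, noise η V Z k ω ^ 2 ∂P ≤ (η / d) ^ 2 * ∫ ω, ‖V k ω‖ ^ 2 ∂P := by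
  have h := W.integral_comp (W.adapted k) (F := fun p => centeredStep η p ^ 2)
    ((measurable_centeredStep η).pow_const 2) (W.integrable_noise_sq k)
  rw [show ∫ ω, noise η V Z k ω ^ 2 ∂P = _ from h, ← integral_const_mul]
  exact integral_mono_of_nonneg (ae_of_all _ fun ω => integral_nonneg fun z => sq_nonneg _)
    ((W.integrable_norm_sq k).const_mul _)
    (ae_of_all _ fun ω => integral_centeredStep_sq_le η (V k ω))

lemma setIntegral_noiseSum_succ_sq (W : SignWalk P η 𝒢 V Z) (n : ℕ) {s : Set Ω}
    (hs : MeasurableSet[𝒢 n] s) :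
    ∫ ω in s, noiseSum η V Z (n + 1) ω ^ 2 ∂P
      = ∫ ω in s, noiseSum η V Z n ω ^ 2 ∂P + ∫ ω in s, noise η V Z n ω ^ 2 ∂P := by
  have e : ∀ ω, noiseSum η V Z (n + 1) ω ^ 2 = noiseSum η V Z n ω ^ 2
      + (2 * (noiseSum η V Z n ω * noise η V Z n ω) + noise η V Z n ω ^ 2) := fun ω => by
    rw [noiseSum, Finset.sum_range_succ, ← noiseSum]; ring
  simp_rw [e]
  have hi := ((W.integrable_noiseSum_mul_noise n).const_mul 2)
  have hi' : Integrable (fun ω => 2 * (noiseSum η V Z n ω * noise η V Z n ω)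
      + noise η V Z n ω ^ 2) P := hi.add (W.integrable_noise_sq n)
  rw [integral_add (W.integrable_noiseSum_sq n).integrableOn hi'.integrableOn,
    integral_add hi.integrableOn (W.integrable_noise_sq n).integrableOn, integral_const_mul,
    W.setIntegral_noiseSum_mul_noise n hs]
  ring

lemma submartingale_noiseSum_sq (W : SignWalk P η 𝒢 V Z) :
    Submartingale (fun n ω => noiseSum η V Z n ω ^ 2) 𝒢 P := by
  refine submartingale_of_setIntegral_le_succ
    (fun n => ((W.measurable_noiseSum n).pow_const 2).stronglyMeasurable)
    W.integrable_noiseSum_sq fun n s hs => ?_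
  rw [W.setIntegral_noiseSum_succ_sq n hs]
  have : 0 ≤ ∫ ω in s, noise η V Z n ω ^ 2 ∂P := integral_nonneg fun ω => sq_nonneg _
  linarith

lemma integral_noiseSum_sq_le (W : SignWalk P η 𝒢 V Z) (n : ℕ) :
    ∫ ω, noiseSum η V Z n ω ^ 2 ∂P
      ≤ ∑ k ∈ Finset.range n, (η / d) ^ 2 * ∫ ω, ‖V k ω‖ ^ 2 ∂P := by
  induction n with
  | zero => simp [noiseSum]
  | succ n ih =>
    have h := W.setIntegral_noiseSum_succ_sq n (s := Set.univ) MeasurableSet.univ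
    simp only [Measure.restrict_univ] at h
    rw [h, Finset.sum_range_succ]
    exact add_le_add ih (W.integral_noise_sq_le n)

/-- Doob's inequality for the martingale part of the risk. -/
lemma measure_exists_le_abs_noiseSum (W : SignWalk P η 𝒢 V Z) (n : ℕ) {a : ℝ} (ha : 0 < a) :
    P {ω | ∃ k ≤ n, a ≤ |noiseSum η V Z k ω|}
      ≤ ENNReal.ofReal ((∫ ω, noiseSum η V Z n ω ^ 2 ∂P) / a ^ 2) := by
  have hd := maximal_ineq W.submartingale_noiseSum_sq (fun k ω => sq_nonneg _)
    (ε := Real.toNNReal (a ^ 2)) n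
  have hc : ((Real.toNNReal (a ^ 2) : NNReal) : ENNReal) = ENNReal.ofReal (a ^ 2) := rfl
  rw [hc] at hd
  have hsub : {ω | ∃ k ≤ n, a ≤ |noiseSum η V Z k ω|} ⊆
      {ω | ((Real.toNNReal (a ^ 2) : NNReal) : ℝ) ≤ (Finset.range (n + 1)).sup'
        Finset.nonempty_range_add_one fun k => noiseSum η V Z k ω ^ 2} := by
    rintro ω ⟨k, hk, hak⟩
    show ((Real.toNNReal (a ^ 2) : NNReal) : ℝ) ≤ _
    rw [Real.coe_toNNReal _ (sq_nonneg a)]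
    refine le_trans ?_ (Finset.le_sup' _ (Finset.mem_range.2 (Nat.lt_succ_of_le hk)))
    rw [← sq_abs (noiseSum η V Z k ω)]
    exact pow_le_pow_left₀ ha.le hak 2
  rw [ENNReal.ofReal_div_of_pos (by positivity), ENNReal.le_div_iff_mul_le
    (Or.inl (by simpa using ha.ne')) (Or.inl ENNReal.ofReal_ne_top), mul_comm]
  refine (mul_le_mul_right (measure_mono hsub) _).trans (hd.trans (ENNReal.ofReal_le_ofReal ?_))
  exact setIntegral_le_integral (W.integrable_noiseSum_sq n) (ae_of_all _ fun ω => sq_nonneg _)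

/-- The initial error contributes `2² = 4`, and each of the at most `T d` steps adds at most `η²/d`.
-/
lemma integral_norm_sq_le (W : SignWalk P η 𝒢 V Z) (hd : 0 < d) {T : ℝ} {k : ℕ}
    (hk : (k : ℝ) ≤ T * d) : ∫ ω, ‖V k ω‖ ^ 2 ∂P ≤ 4 + T * η ^ 2 := by
  have h : ∫ ω, ‖V k ω‖ ^ 2 ∂P ≤ 4 + k * ((η / d) ^ 2 * d) := by
    clear hk
    induction k with
    | zero =>
      calc ∫ ω, ‖V 0 ω‖ ^ 2 ∂P ≤ ∫ _ω, (4 : ℝ) ∂P := by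
            refine integral_mono_ae (W.integrable_norm_sq 0) (integrable_const _) ?_
            filter_upwards [W.init] with ω h
            nlinarith [norm_nonneg (V 0 ω)]
        _ = 4 + ((0 : ℕ) : ℝ) * ((η / d) ^ 2 * d) := by simp
    | succ k ih =>
      have := W.integral_norm_sq_succ_le k
      push_cast
      linarith
  have hd' : (0 : ℝ) < d := by exact_mod_cast hd
  have h2 : (k : ℝ) * ((η / d) ^ 2 * d) ≤ T * d * ((η / d) ^ 2 * d) := by gcongr
  have h3 : T * d * ((η / d) ^ 2 * d) = T * η ^ 2 := by field_simp
  linarith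

lemma integral_quartic_le (W : SignWalk P η 𝒢 V Z) (hd : 0 < d) {T q : ℝ}
    (hq : ∫ ω, quartic (V 0 ω) ∂P ≤ q / d) {k : ℕ} (hk : (k : ℝ) ≤ T * d) :
    ∫ ω, quartic (V k ω) ∂P ≤ (q + T * (6 * η ^ 2 * (4 + T * η ^ 2) + η ^ 4)) / d := by
  have hd1 : (1 : ℝ) ≤ d := by exact_mod_cast hd
  have hd' : (0 : ℝ) < d := by linarith
  have hT : 0 ≤ T := by
    by_contra hT
    have : T * d < 0 := mul_neg_of_neg_of_pos (not_le.mp hT) hd'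
    linarith [Nat.cast_nonneg (α := ℝ) k]
  have hK : 0 ≤ 4 + T * η ^ 2 := by positivity
  set c := 6 * (η / d) ^ 2 * (4 + T * η ^ 2) + (η / d) ^ 4 * d with hc
  have hc0 : 0 ≤ c := by positivity
  have h : ∫ ω, quartic (V k ω) ∂P ≤ q / d + k * c := by
    induction k with
    | zero => simpa using hq
    | succ k ih =>
      have hk' : (k : ℝ) ≤ T * d := by push_cast at hk; linarith
      have h1 := W.integral_quartic_succ_le k
      have h2 := mul_le_mul_of_nonneg_left (W.integral_norm_sq_le hd hk')
        (by positivity : 0 ≤ 6 * (η / d) ^ 2)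
      have h3 := ih hk'
      push_cast
      rw [add_mul, one_mul, hc] at *
      linarith
  have h2 : (k : ℝ) * c ≤ T * d * c := by gcongr
  have h3 : T * d * c ≤ T * (6 * η ^ 2 * (4 + T * η ^ 2) + η ^ 4) / d := by
    have e : T * d * c = T * (6 * η ^ 2 * (4 + T * η ^ 2) + η ^ 4 / d) / d := by
      rw [hc]; field_simp
    rw [e]
    have : η ^ 4 / d ≤ η ^ 4 := div_le_self (by positivity) hd1
    gcongr
  rw [add_div]
  linarith

lemma measure_exists_le_abs_noiseSum_le (W : SignWalk P η 𝒢 V Z) (hd : 0 < d) {T : ℝ} (hT : 0 ≤ T)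
    {a : ℝ} (ha : 0 < a) :
    P {ω | ∃ k ≤ ⌊T * d⌋₊, a ≤ |noiseSum η V Z k ω|}
      ≤ ENNReal.ofReal (T * η ^ 2 * (4 + T * η ^ 2) / a ^ 2 / d) := by
  have hd' : (0 : ℝ) < d := by exact_mod_cast hd
  have hN : ((⌊T * d⌋₊ : ℕ) : ℝ) ≤ T * d := Nat.floor_le (by positivity)
  refine (W.measure_exists_le_abs_noiseSum _ ha).trans (ENNReal.ofReal_le_ofReal ?_)
  rw [div_right_comm]
  gcongr
  calc ∫ ω, noiseSum η V Z ⌊T * d⌋₊ ω ^ 2 ∂P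
      ≤ ∑ k ∈ Finset.range ⌊T * d⌋₊, (η / d) ^ 2 * ∫ ω, ‖V k ω‖ ^ 2 ∂P :=
        W.integral_noiseSum_sq_le _
    _ ≤ ∑ _k ∈ Finset.range ⌊T * d⌋₊, (η / d) ^ 2 * (4 + T * η ^ 2) := by
        refine Finset.sum_le_sum fun k hk => ?_
        have : (k : ℝ) ≤ T * d := le_trans (by exact_mod_cast (Finset.mem_range.1 hk).le) hN
        gcongr
        exact W.integral_norm_sq_le hd this
    _ = (⌊T * d⌋₊ : ℕ) * ((η / d) ^ 2 * (4 + T * η ^ 2)) := by simp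
    _ ≤ T * d * ((η / d) ^ 2 * (4 + T * η ^ 2)) := by gcongr
    _ = T * η ^ 2 * (4 + T * η ^ 2) / d := by field_simp

/-- Markov's inequality: there are at most `T d` terms, each of mean `O(1/d²)`. -/
lemma measure_le_sum_quartic_le (W : SignWalk P η 𝒢 V Z) (hd : 0 < d) {T q : ℝ} (hT : 0 ≤ T)
    (hq0 : 0 ≤ q) (hq : ∫ ω, quartic (V 0 ω) ∂P ≤ q / d) {b : ℝ} (hb : 0 < b) :
    P {ω | b ≤ ∑ k ∈ Finset.range ⌊T * d⌋₊, η / d * (cubicConst η * quartic (V k ω))}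
      ≤ ENNReal.ofReal (T * η * cubicConst η
          * (q + T * (6 * η ^ 2 * (4 + T * η ^ 2) + η ^ 4)) / b / d) := by
  have hd' : (0 : ℝ) < d := by exact_mod_cast hd
  have hN : ((⌊T * d⌋₊ : ℕ) : ℝ) ≤ T * d := Nat.floor_le (by positivity)
  have hη := W.pos
  have hC := cubicConst_nonneg hη
  set K := q + T * (6 * η ^ 2 * (4 + T * η ^ 2) + η ^ 4) with hK
  have hK0 : 0 ≤ K := by positivity
  have hi : ∀ k, Integrable (fun ω => η / d * (cubicConst η * quartic (V k ω))) P := fun k =>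
    ((W.integrable_quartic k).const_mul _).const_mul _
  have hm := mul_meas_ge_le_integral_of_nonneg (μ := P)
    (f := fun ω => ∑ k ∈ Finset.range ⌊T * d⌋₊, η / d * (cubicConst η * quartic (V k ω)))
    (ae_of_all _ fun ω => Finset.sum_nonneg fun k _ =>
      mul_nonneg W.div_nonneg (mul_nonneg hC (quartic_nonneg _)))
    (integrable_finsetSum _ fun k _ => hi k) b
  have hI : ∫ ω, ∑ k ∈ Finset.range ⌊T * d⌋₊, η / d * (cubicConst η * quartic (V k ω)) ∂P
      ≤ T * η * cubicConst η * K / d := by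
    rw [integral_finsetSum _ fun k _ => hi k]
    calc ∑ k ∈ Finset.range ⌊T * d⌋₊, ∫ ω, η / d * (cubicConst η * quartic (V k ω)) ∂P
        ≤ ∑ _k ∈ Finset.range ⌊T * d⌋₊, η / d * (cubicConst η * (K / d)) := by
          refine Finset.sum_le_sum fun k hk => ?_
          have : (k : ℝ) ≤ T * d := le_trans (by exact_mod_cast (Finset.mem_range.1 hk).le) hN
          rw [integral_const_mul, integral_const_mul]
          gcongr
          exact W.integral_quartic_le hd hq this
      _ = (⌊T * d⌋₊ : ℕ) * (η / d * (cubicConst η * (K / d))) := by simp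
      _ ≤ T * d * (η / d * (cubicConst η * (K / d))) := by gcongr
      _ = T * η * cubicConst η * K / d := by field_simp
  rw [← ENNReal.ofReal_toReal (measure_ne_top P _)]
  refine ENNReal.ofReal_le_ofReal ?_
  rw [div_right_comm, le_div_iff₀ hb, mul_comm]
  exact hm.trans hI

end SignWalk

end Walk

/-! ### The risk equation and stability of its Euler scheme. -/

section RiskODE

/-- The right-hand side of the risk equation. -/
noncomputable def riskRate (η r : ℝ) : ℝ :=
  η * (η / 2 - 4 * r / (Real.pi * Real.sqrt (2 * r + η ^ 2)))

lemma riskRate_zero (η : ℝ) : riskRate η 0 = η ^ 2 / 2 := by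
  simp [riskRate]; ring

lemma riskRate_le {η r : ℝ} (hη : 0 < η) (hr : 0 ≤ r) : riskRate η r ≤ η ^ 2 / 2 := by
  have : 0 ≤ 4 * r / (Real.pi * Real.sqrt (2 * r + η ^ 2)) := by positivity
  rw [riskRate]
  nlinarith

/-- In the variable `A = √(2r + η²)` the nonlinear term is `(2/π)(A - η²/A)`. Since `A ≥ η`, its
difference quotient in `r`, multiplied by `η`, is at most `4/π ≤ 2`, independently of `η`. -/
lemma abs_riskRate_sub_le {η r s : ℝ} (hη : 0 < η) (hr : 0 ≤ r) (hs : 0 ≤ s) :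
    |riskRate η r - riskRate η s| ≤ 2 * |r - s| := by
  have hp := Real.pi_gt_three
  set A := Real.sqrt (2 * r + η ^ 2) with hA
  set B := Real.sqrt (2 * s + η ^ 2) with hB
  have hA2 : A ^ 2 = 2 * r + η ^ 2 := Real.sq_sqrt (by positivity)
  have hB2 : B ^ 2 = 2 * s + η ^ 2 := Real.sq_sqrt (by positivity)
  have hAη : η ≤ A := Real.le_sqrt_of_sq_le (by linarith)
  have hBη : η ≤ B := Real.le_sqrt_of_sq_le (by linarith)
  have hA0 : 0 < A := hη.trans_le hAη
  have hB0 : 0 < B := hη.trans_le hBη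
  have e : riskRate η r - riskRate η s
      = -(4 / Real.pi * η * ((1 + η ^ 2 / (A * B)) / (A + B))) * (r - s) := by
    rw [riskRate, riskRate, ← hA, ← hB]
    have hr' : r = (A ^ 2 - η ^ 2) / 2 := by linarith
    have hs' : s = (B ^ 2 - η ^ 2) / 2 := by linarith
    rw [hr', hs']
    field_simp
    ring
  have hk : 4 / Real.pi * η * ((1 + η ^ 2 / (A * B)) / (A + B)) ≤ 2 := by
    have h1 : η ^ 2 / (A * B) ≤ 1 := by
      rw [div_le_one (by positivity), sq]
      exact mul_le_mul hAη hBη hη.le hA0.le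
    have h2 : (1 + η ^ 2 / (A * B)) / (A + B) ≤ 1 / η := by
      rw [div_le_div_iff₀ (by positivity) hη]
      nlinarith
    have h3 : 4 / Real.pi ≤ 2 := by
      rw [div_le_iff₀ (by linarith)]; linarith
    calc 4 / Real.pi * η * ((1 + η ^ 2 / (A * B)) / (A + B)) ≤ 2 * η * (1 / η) := by gcongr
      _ = 2 := by field_simp
  rw [e, abs_mul, abs_neg, abs_of_nonneg (by positivity)]
  exact mul_le_mul_of_nonneg_right hk (abs_nonneg _)

lemma abs_riskRate_le {η r : ℝ} (hη : 0 < η) (hr : 0 ≤ r) :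
    |riskRate η r| ≤ η ^ 2 / 2 + 2 * r := by
  have h := abs_riskRate_sub_le hη hr le_rfl
  rw [riskRate_zero, sub_zero, abs_of_nonneg hr] at h
  have h1 : |η ^ 2 / 2| = η ^ 2 / 2 := abs_of_nonneg (by positivity)
  have h2 := abs_add_le (riskRate η r - η ^ 2 / 2) (η ^ 2 / 2)
  rw [sub_add_cancel] at h2
  linarith

/-- A bound for the speed of the risk curve on `[0, T]`. -/
noncomputable def speed (η r₀ T : ℝ) : ℝ :=
  η ^ 2 / 2 + 2 * (r₀ + η ^ 2 / 2 * T)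

namespace IsRiskSolution

variable {η r₀ : ℝ} {ρ : ℝ → ℝ}

lemma hasDerivWithinAt (h : IsRiskSolution η r₀ ρ) {t : ℝ} (ht : 0 ≤ t) :
    HasDerivWithinAt ρ (riskRate η (ρ t)) (Set.Ici 0) t := h.2 t ht

lemma continuousOn (h : IsRiskSolution η r₀ ρ) : ContinuousOn ρ (Set.Ici 0) := fun _ ht =>
  (h.hasDerivWithinAt ht).continuousWithinAt

/-- Zero is a barrier: there the rate equals `η²/2 > 0`. -/
lemma nonneg (h : IsRiskSolution η r₀ ρ) (hη : 0 < η) (h0 : 0 ≤ r₀) {t : ℝ} (ht : 0 ≤ t) :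
    0 ≤ ρ t := by
  have := image_le_of_deriv_right_lt_deriv_boundary' (f := fun t => -ρ t)
    (f' := fun t => -riskRate η (ρ t)) (a := 0) (b := t) (B := fun _ => 0) (B' := fun _ => 0)
    ((h.continuousOn.mono Set.Icc_subset_Ici_self).neg)
    (fun x hx => ((h.hasDerivWithinAt hx.1).mono (Set.Ici_subset_Ici.2 hx.1)).neg)
    (by rw [h.1]; linarith) continuousOn_const (fun x _ => hasDerivWithinAt_const _ _ _)
    (fun x _ hx => by
      have : ρ x = 0 := by linarith
      rw [this, riskRate_zero]
      have : 0 < η ^ 2 := by positivity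
      linarith) (x := t) ⟨ht, le_rfl⟩
  linarith

lemma le_add (h : IsRiskSolution η r₀ ρ) (hη : 0 < η) (h0 : 0 ≤ r₀) {t : ℝ} (ht : 0 ≤ t) :
    ρ t ≤ r₀ + η ^ 2 / 2 * t := by
  refine image_le_of_deriv_right_le_deriv_boundary (f := ρ) (f' := fun t => riskRate η (ρ t))
    (a := 0) (b := t) (B := fun t => r₀ + η ^ 2 / 2 * t) (B' := fun _ => η ^ 2 / 2)
    (h.continuousOn.mono Set.Icc_subset_Ici_self)
    (fun x hx => (h.hasDerivWithinAt hx.1).mono (Set.Ici_subset_Ici.2 hx.1))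
    (by rw [h.1]; simp) (by fun_prop)
    (fun x _ => by
      simpa using (((hasDerivAt_id x).const_mul (η ^ 2 / 2)).const_add r₀).hasDerivWithinAt)
    (fun x hx => riskRate_le hη (h.nonneg hη h0 hx.1)) ⟨ht, le_rfl⟩

lemma abs_riskRate_le (h : IsRiskSolution η r₀ ρ) (hη : 0 < η) (h0 : 0 ≤ r₀) {t T : ℝ}
    (ht : 0 ≤ t) (hT : t ≤ T) : |riskRate η (ρ t)| ≤ speed η r₀ T := by
  refine (IsotropicSignSGD.abs_riskRate_le hη (h.nonneg hη h0 ht)).trans ?_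
  have := h.le_add hη h0 ht
  have : η ^ 2 / 2 * t ≤ η ^ 2 / 2 * T := by gcongr
  rw [speed]
  linarith

lemma abs_sub_le (h : IsRiskSolution η r₀ ρ) (hη : 0 < η) (h0 : 0 ≤ r₀) {s t T : ℝ}
    (hs : 0 ≤ s) (hst : s ≤ t) (hT : t ≤ T) : |ρ t - ρ s| ≤ speed η r₀ T * (t - s) := by
  have := (convex_Icc (0 : ℝ) T).norm_image_sub_le_of_norm_hasDerivWithin_le (f := ρ)
    (f' := fun u => riskRate η (ρ u)) (C := speed η r₀ T)
    (fun u hu => (h.hasDerivWithinAt hu.1).mono Set.Icc_subset_Ici_self)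
    (fun u hu => h.abs_riskRate_le hη h0 hu.1 hu.2) (x := s) (y := t)
    ⟨hs, hst.trans hT⟩ ⟨hs.trans hst, hT⟩
  rwa [Real.norm_eq_abs, Real.norm_of_nonneg (sub_nonneg.2 hst)] at this

/-- The local error of the explicit Euler scheme. -/
lemma abs_sub_euler_le (h : IsRiskSolution η r₀ ρ) (hη : 0 < η) (h0 : 0 ≤ r₀) {s t T : ℝ}
    (hs : 0 ≤ s) (hst : s ≤ t) (hT : t ≤ T) :
    |ρ t - ρ s - (t - s) * riskRate η (ρ s)| ≤ 2 * speed η r₀ T * (t - s) ^ 2 := by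
  have hsp : 0 ≤ speed η r₀ T :=
    (abs_nonneg _).trans (h.abs_riskRate_le hη h0 hs (hst.trans hT))
  have := (convex_Icc s t).norm_image_sub_le_of_norm_hasDerivWithin_le
    (f := fun u => ρ u - u * riskRate η (ρ s))
    (f' := fun u => riskRate η (ρ u) - riskRate η (ρ s)) (C := 2 * (speed η r₀ T * (t - s)))
    (fun u hu => by
      refine ((h.hasDerivWithinAt (hs.trans hu.1)).mono
        (Set.Icc_subset_Ici_self.trans (Set.Ici_subset_Ici.2 hs))).sub ?_
      simpa using ((hasDerivAt_id u).mul_const (riskRate η (ρ s))).hasDerivWithinAt)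
    (fun u hu => by
      refine (abs_riskRate_sub_le hη (h.nonneg hη h0 (hs.trans hu.1)) (h.nonneg hη h0 hs)).trans ?_
      have h1 := h.abs_sub_le hη h0 hs hu.1 (hu.2.trans hT)
      have h2 : speed η r₀ T * (u - s) ≤ speed η r₀ T * (t - s) := by
        gcongr
        exact hu.2
      linarith) (x := s) (y := t) ⟨le_rfl, hst⟩ ⟨hst, le_rfl⟩
  rw [Real.norm_eq_abs, Real.norm_of_nonneg (sub_nonneg.2 hst)] at this
  convert this using 1
  · congr 1; ring
  · ring

end IsRiskSolution

/-- Stability of the explicit Euler scheme of the risk equation under a perturbation that is the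
sum of a sequence with small partial sums and an absolutely small sequence. -/
lemma abs_sub_le_of_perturbed_euler {η h c A B : ℝ} (hη : 0 < η) (hh : 0 ≤ h) (hc : 0 ≤ c)
    (hA0 : 0 ≤ A) {N : ℕ}
    {R r a b : ℕ → ℝ} (hR : ∀ k, 0 ≤ R k) (hr : ∀ k, 0 ≤ r k) (h0 : r 0 = R 0)
    (hstep : ∀ k, R (k + 1) = R k + h * riskRate η (R k) + a k + b k)
    (hrstep : ∀ k < N, |r (k + 1) - r k - h * riskRate η (r k)| ≤ c)
    (hA : ∀ n ≤ N, |∑ k ∈ Finset.range n, a k| ≤ A)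
    (hB : ∑ k ∈ Finset.range N, |b k| ≤ B) {n : ℕ} (hn : n ≤ N) :
    |R n - r n| ≤ A + (N * (2 * h * A + c) + B) * Real.exp (2 * h * N) := by
  -- The sequence `a` is small only through its partial sums, so these are subtracted before
  -- Grönwall; they re-enter through the Lipschitz bound as `2 h A` per step.
  set D : ℕ → ℝ := fun n => R n - r n - ∑ k ∈ Finset.range n, a k with hD
  have hD1 : ∀ n ≤ N, |D n|
      ≤ (∑ k ∈ Finset.range n, (2 * h * A + c + |b k|)) * (1 + 2 * h) ^ n := by
    intro n hn
    induction n with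
    | zero => simp [hD, h0]
    | succ n ih =>
      have ih := ih (by omega)
      have e : D (n + 1) = D n + h * (riskRate η (R n) - riskRate η (r n)) + b n
          - (r (n + 1) - r n - h * riskRate η (r n)) := by
        simp only [hD]
        rw [hstep, Finset.sum_range_succ]
        ring
      have h1 := abs_riskRate_sub_le hη (hR n) (hr n)
      have h2 : |R n - r n| ≤ |D n| + A := by
        have : R n - r n = D n + ∑ k ∈ Finset.range n, a k := by simp only [hD]; ring
        rw [this]
        exact (abs_add_le _ _).trans (add_le_add le_rfl (hA n (by omega)))
      have h3 : |h * (riskRate η (R n) - riskRate η (r n))| ≤ h * (2 * (|D n| + A)) := by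
        rw [abs_mul, abs_of_nonneg hh]
        gcongr
        linarith
      have h4 : |D (n + 1)| ≤ (1 + 2 * h) * |D n| + (2 * h * A + c + |b n|) := by
        rw [e]
        have i1 := abs_sub (D n + h * (riskRate η (R n) - riskRate η (r n)) + b n)
          (r (n + 1) - r n - h * riskRate η (r n))
        have i2 := abs_add_le (D n + h * (riskRate η (R n) - riskRate η (r n))) (b n)
        have i3 := abs_add_le (D n) (h * (riskRate η (R n) - riskRate η (r n)))
        have i4 := hrstep n (by omega)
        linarith
      rw [Finset.sum_range_succ, add_mul]
      have h5 : (1 : ℝ) ≤ (1 + 2 * h) ^ (n + 1) := one_le_pow₀ (by linarith)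
      have h6 : 0 ≤ 2 * h * A + c + |b n| := by positivity
      have h7 := mul_le_mul_of_nonneg_left ih (by linarith : 0 ≤ 1 + 2 * h)
      have h8 := mul_le_mul_of_nonneg_left h5 h6
      rw [pow_succ] at *
      linarith
  have hsum : ∑ k ∈ Finset.range n, (2 * h * A + c + |b k|) ≤ N * (2 * h * A + c) + B := by
    rw [Finset.sum_add_distrib, Finset.sum_const, Finset.card_range, nsmul_eq_mul]
    have i1 : (n : ℝ) * (2 * h * A + c) ≤ N * (2 * h * A + c) := by gcongr
    have i2 : ∑ k ∈ Finset.range n, |b k| ≤ ∑ k ∈ Finset.range N, |b k| :=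
      Finset.sum_le_sum_of_subset_of_nonneg (by simpa using hn) fun _ _ _ => abs_nonneg _
    linarith
  have hsum0 : 0 ≤ ∑ k ∈ Finset.range n, (2 * h * A + c + |b k|) :=
    Finset.sum_nonneg fun k _ => by positivity
  have hexp : (1 + 2 * h) ^ n ≤ Real.exp (2 * h * N) := by
    calc (1 + 2 * h) ^ n ≤ Real.exp (2 * h) ^ n := by
          gcongr
          linarith [Real.add_one_le_exp (2 * h)]
      _ = Real.exp (2 * h * n) := by rw [← Real.exp_nat_mul]; congr 1; ring
      _ ≤ Real.exp (2 * h * N) := by gcongr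
  have hfin : |D n| ≤ (N * (2 * h * A + c) + B) * Real.exp (2 * h * N) :=
    (hD1 n hn).trans (mul_le_mul hsum hexp (by positivity) (hsum0.trans hsum))
  have : R n - r n = D n + ∑ k ∈ Finset.range n, a k := by simp only [hD]; ring
  rw [this]
  have := (abs_add_le (D n) (∑ k ∈ Finset.range n, a k)).trans
    (add_le_add hfin (hA n hn))
  linarith

/-- Euler stability with step `1/d` handles the grid points; rounding `t` down to the grid costs at
most one more `speed / d`. The bound `R 0 ≤ 2` makes the right-hand side independent of the initial
condition. -/
lemma abs_sub_riskSolution_le {η T A B : ℝ} {d : ℕ} (hη : 0 < η) (hd : 0 < d)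
    (hA0 : 0 ≤ A) {R a b : ℕ → ℝ} {ρ : ℝ → ℝ} (hρ : IsRiskSolution η (R 0) ρ) (hR : ∀ k, 0 ≤ R k)
    (hR0 : R 0 ≤ 2) (hstep : ∀ k, R (k + 1) = R k + 1 / d * riskRate η (R k) + a k + b k)
    (hA : ∀ n ≤ ⌊T * d⌋₊, |∑ k ∈ Finset.range n, a k| ≤ A)
    (hB : ∑ k ∈ Finset.range ⌊T * d⌋₊, |b k| ≤ B) {t : ℝ} (ht : t ∈ Set.Icc 0 T) :
    |R ⌊t * d⌋₊ - ρ t| ≤ A + (2 * T * A + B + 2 * T * speed η 2 T / d) * Real.exp (2 * T)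
      + speed η 2 T / d := by
  have hd' : (0 : ℝ) < d := by exact_mod_cast hd
  have hT : 0 ≤ T := ht.1.trans ht.2
  have hN : ((⌊T * d⌋₊ : ℕ) : ℝ) ≤ T * d := Nat.floor_le (by positivity)
  have hsp : speed η (R 0) T ≤ speed η 2 T := by
    rw [speed, speed]; linarith
  have hsp0 : 0 ≤ speed η (R 0) T := by
    have := hR 0
    rw [speed]; positivity
  have hB0 : 0 ≤ B := (Finset.sum_nonneg fun k _ => abs_nonneg _).trans hB
  have hnT : ∀ {n : ℕ}, n ≤ ⌊T * d⌋₊ → (n : ℝ) / d ≤ T := fun {n} hn => by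
    rw [div_le_iff₀ hd']
    exact le_trans (by exact_mod_cast hn) hN
  have h1 := abs_sub_le_of_perturbed_euler (h := 1 / d) (c := 2 * speed η (R 0) T * (1 / d) ^ 2)
    (r := fun k => ρ (k / d)) hη (by positivity) (by positivity) hA0 hR
    (fun k => hρ.nonneg hη (hR 0) (by positivity)) (by simp [hρ.1]) hstep
    (fun k hk => by
      have hle : (k : ℝ) / d ≤ ((k + 1 : ℕ) : ℝ) / d := by gcongr; simp
      have e : ((k + 1 : ℕ) : ℝ) / d - (k : ℝ) / d = 1 / d := by push_cast; ring
      have := hρ.abs_sub_euler_le hη (hR 0) (by positivity) hle (hnT (Nat.succ_le_of_lt hk))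
      rwa [e] at this)
    hA hB (n := ⌊t * d⌋₊) (Nat.floor_le_floor (by gcongr; exact ht.2))
  have hfl : ((⌊t * d⌋₊ : ℕ) : ℝ) ≤ t * d := Nat.floor_le (mul_nonneg ht.1 hd'.le)
  have hlf : t * d < (⌊t * d⌋₊ : ℕ) + 1 := Nat.lt_floor_add_one _
  have hle : ((⌊t * d⌋₊ : ℕ) : ℝ) / d ≤ t := by rwa [div_le_iff₀ hd']
  have hsub : t - ((⌊t * d⌋₊ : ℕ) : ℝ) / d ≤ 1 / d := by
    rw [sub_le_iff_le_add, ← add_div, le_div_iff₀ hd']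
    linarith
  have h2 := hρ.abs_sub_le hη (hR 0) (by positivity) hle ht.2
  have h3 : speed η (R 0) T * (t - ((⌊t * d⌋₊ : ℕ) : ℝ) / d) ≤ speed η 2 T / d := by
    rw [div_eq_mul_one_div (speed η 2 T)]
    exact mul_le_mul hsp hsub (sub_nonneg.2 hle) (hsp0.trans hsp)
  have h4 : (⌊T * d⌋₊ : ℕ) * (2 * (1 / d) * A + 2 * speed η (R 0) T * (1 / d) ^ 2) + B
      ≤ 2 * T * A + B + 2 * T * speed η 2 T / d := by
    calc (⌊T * d⌋₊ : ℕ) * (2 * (1 / d) * A + 2 * speed η (R 0) T * (1 / d) ^ 2) + B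
        ≤ T * d * (2 * (1 / d) * A + 2 * speed η 2 T * (1 / d) ^ 2) + B := by gcongr
      _ = 2 * T * A + B + 2 * T * speed η 2 T / d := by field_simp; ring
  have h5 : Real.exp (2 * (1 / d) * (⌊T * d⌋₊ : ℕ)) ≤ Real.exp (2 * T) := by
    rw [Real.exp_le_exp]
    calc 2 * (1 / (d : ℝ)) * (⌊T * d⌋₊ : ℕ) ≤ 2 * (1 / d) * (T * d) := by gcongr
      _ = 2 * T := by field_simp
  have h6 := mul_le_mul h4 h5 (Real.exp_pos _).le (le_trans (by positivity) h4)
  have h7 := abs_add_le (R ⌊t * d⌋₊ - ρ ((⌊t * d⌋₊ : ℕ) / d)) (ρ ((⌊t * d⌋₊ : ℕ) / d) - ρ t)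
  rw [sub_add_sub_cancel, abs_sub_comm (ρ _) (ρ t)] at h7
  linarith

end RiskODE

/-! ### Rotation invariance and fourth moments of the initial law. -/

section NormalizedGaussian

variable {d : ℕ}

lemma measurable_normalize : Measurable fun g : Vec d => ‖g‖⁻¹ • g :=
  measurable_norm.inv.smul measurable_id

instance isProbabilityMeasure_normalizedGaussian : IsProbabilityMeasure (normalizedGaussian d) :=
  Measure.isProbabilityMeasure_map measurable_normalize.aemeasurable

lemma ae_norm_le_one_normalizedGaussian : ∀ᵐ θ ∂normalizedGaussian d, ‖θ‖ ≤ 1 := by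
  rw [normalizedGaussian, ae_map_iff measurable_normalize.aemeasurable
    (measurableSet_le measurable_norm measurable_const)]
  refine ae_of_all _ fun g => ?_
  rw [norm_smul, norm_inv, norm_norm]
  exact inv_mul_le_one

lemma normalizedGaussian_map (f : Vec d ≃ₗᵢ[ℝ] Vec d) :
    (normalizedGaussian d).map f = normalizedGaussian d := by
  have hf : Measurable f := f.continuous.measurable
  rw [normalizedGaussian, Measure.map_map hf measurable_normalize]
  conv_rhs => rw [← stdGaussian_map f, Measure.map_map measurable_normalize hf]
  congr 1
  funext g
  simp

lemma integrable_of_abs_le_normalizedGaussian {f : Vec d → ℝ} (hf : Measurable f) {C : ℝ}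
    (h : ∀ θ, ‖θ‖ ≤ 1 → |f θ| ≤ C) : Integrable f (normalizedGaussian d) := by
  refine Integrable.of_bound hf.aestronglyMeasurable C ?_
  filter_upwards [ae_norm_le_one_normalizedGaussian] with θ hθ using h θ hθ

lemma integral_inner_pow_four_eq {u w : Vec d} (h : ‖u‖ = ‖w‖) :
    ∫ θ, inner ℝ θ u ^ 4 ∂normalizedGaussian d = ∫ θ, inner ℝ θ w ^ 4 ∂normalizedGaussian d := by
  -- The reflection in the hyperplane orthogonal to `u - w` carries `u` to `w`, as their norms
  -- agree.
  set f := (Submodule.span ℝ {u - w})ᗮ.reflection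
  have hfu : f u = w := Submodule.reflection_sub h
  have hm : Measurable fun θ : Vec d => (inner ℝ θ w : ℝ) ^ 4 := by fun_prop
  conv_rhs => rw [← normalizedGaussian_map f]
  rw [integral_map f.continuous.measurable.aemeasurable hm.aestronglyMeasurable]
  refine integral_congr_ae (ae_of_all _ fun θ => ?_)
  show (inner ℝ θ u : ℝ) ^ 4 = inner ℝ (f θ) w ^ 4
  rw [← hfu, f.inner_map_map]

lemma abs_apply_le_one {θ : Vec d} (h : ‖θ‖ ≤ 1) (i : Fin d) : |θ i| ≤ 1 :=
  (PiLp.norm_apply_le θ i).trans h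

lemma integrable_sq_mul_sq (i j : Fin d) :
    Integrable (fun θ : Vec d => θ i ^ 2 * θ j ^ 2) (normalizedGaussian d) := by
  refine integrable_of_abs_le_normalizedGaussian (by fun_prop) (C := 1) fun θ h => ?_
  rw [abs_mul, abs_pow, abs_pow]
  exact mul_le_one₀ (pow_le_one₀ (abs_nonneg _) (abs_apply_le_one h i)) (by positivity)
    (pow_le_one₀ (abs_nonneg _) (abs_apply_le_one h j))

lemma integrable_apply_pow_four (i : Fin d) :
    Integrable (fun θ : Vec d => θ i ^ 4) (normalizedGaussian d) := by
  refine integrable_of_abs_le_normalizedGaussian (by fun_prop) (C := 1) fun θ h => ?_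
  rw [abs_pow]
  exact pow_le_one₀ (abs_nonneg _) (abs_apply_le_one h i)

/-- For `i ≠ j`, invariance equates the fourth moments of `√2 θ i`, `θ i + θ j` and `θ i - θ j`.
Adding the last two identities gives equality, without computing any law on the sphere. For `i = j`
the factor `3` is merely generous. -/
lemma integral_pow_four_le_three_mul (i j : Fin d) :
    ∫ θ, θ i ^ 4 ∂normalizedGaussian d
      ≤ 3 * ∫ θ, θ i ^ 2 * θ j ^ 2 ∂normalizedGaussian d := by
  rcases eq_or_ne i j with rfl | hij
  · rw [← integral_const_mul]
    refine integral_mono (integrable_apply_pow_four i) ((integrable_sq_mul_sq i i).const_mul 3)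
      fun θ => ?_
    show θ i ^ 4 ≤ 3 * (θ i ^ 2 * θ i ^ 2)
    nlinarith [sq_nonneg (θ i ^ 2)]
  · let b : Fin d → Vec d := fun k => EuclideanSpace.single k (1 : ℝ)
    have hin : ∀ (θ : Vec d) (k : Fin d), (inner ℝ θ (b k) : ℝ) = θ k := fun θ k => by
      simp [b, EuclideanSpace.inner_single_right]
    have hb : ∀ k, ‖b k‖ = 1 := fun k => by simp [b]
    have hort : (inner ℝ (b i) (b j) : ℝ) = 0 := by
      rw [hin]; simp [b, hij]
    have h2 : ‖Real.sqrt 2 • b i‖ = Real.sqrt 2 := by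
      rw [norm_smul, hb, mul_one, Real.norm_of_nonneg (Real.sqrt_nonneg 2)]
    have hsq : ∀ y : Vec d, ‖y‖ ^ 2 = 2 → ‖Real.sqrt 2 • b i‖ = ‖y‖ := fun y hy => by
      rw [h2, ← hy, Real.sqrt_sq (norm_nonneg _)]
    have hp := integral_inner_pow_four_eq (hsq (b i + b j) (by
      rw [norm_add_sq_real, hort, hb, hb]; norm_num))
    have hm := integral_inner_pow_four_eq (hsq (b i - b j) (by
      rw [norm_sub_sq_real, hort, hb, hb]; norm_num))
    have hji := integral_inner_pow_four_eq (show ‖b i‖ = ‖b j‖ by rw [hb, hb])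
    simp only [inner_add_right, inner_sub_right, inner_smul_right, hin, mul_pow] at hp hm hji
    have h4 : Real.sqrt 2 ^ 4 = 4 := by
      rw [show Real.sqrt 2 ^ 4 = (Real.sqrt 2 ^ 2) ^ 2 by ring, Real.sq_sqrt (by norm_num)]
      norm_num
    rw [integral_const_mul, h4] at hp hm
    have hip : Integrable (fun θ : Vec d => (θ i + θ j) ^ 4) (normalizedGaussian d) := by
      refine integrable_of_abs_le_normalizedGaussian (by fun_prop) (C := 2 ^ 4) fun θ h => ?_
      rw [abs_pow]
      refine pow_le_pow_left₀ (abs_nonneg _) ((abs_add_le _ _).trans ?_) 4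
      linarith [abs_apply_le_one h i, abs_apply_le_one h j]
    have him : Integrable (fun θ : Vec d => (θ i - θ j) ^ 4) (normalizedGaussian d) := by
      refine integrable_of_abs_le_normalizedGaussian (by fun_prop) (C := 2 ^ 4) fun θ h => ?_
      rw [abs_pow]
      refine pow_le_pow_left₀ (abs_nonneg _) ((abs_sub _ _).trans ?_) 4
      linarith [abs_apply_le_one h i, abs_apply_le_one h j]
    have hadd := integral_add hip him
    have e : ∀ θ : Vec d, (θ i + θ j) ^ 4 + (θ i - θ j) ^ 4
        = 2 * θ i ^ 4 + 2 * θ j ^ 4 + 12 * (θ i ^ 2 * θ j ^ 2) := fun θ => by ring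
    have hi2 : Integrable (fun θ : Vec d => 2 * θ i ^ 4 + 2 * θ j ^ 4) (normalizedGaussian d) :=
      ((integrable_apply_pow_four i).const_mul 2).add ((integrable_apply_pow_four j).const_mul 2)
    simp_rw [e] at hadd
    rw [integral_add hi2 ((integrable_sq_mul_sq i j).const_mul 12),
      integral_add ((integrable_apply_pow_four i).const_mul 2)
        ((integrable_apply_pow_four j).const_mul 2), integral_const_mul, integral_const_mul,
      integral_const_mul] at hadd
    linarith

/-- A normalized Gaussian vector is delocalised. -/
lemma integral_quartic_normalizedGaussian_le :
    ∫ θ, quartic θ ∂normalizedGaussian d ≤ 3 / d := by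
  rcases Nat.eq_zero_or_pos d with h0 | h0
  · subst h0; simp [quartic]
  have hd : (0 : ℝ) < d := by exact_mod_cast h0
  have hq : ∫ θ, quartic θ ∂normalizedGaussian d
      = ∑ i : Fin d, ∫ θ, θ i ^ 4 ∂normalizedGaussian d :=
    integral_finsetSum _ fun i _ => integrable_apply_pow_four i
  have hone : ∑ i : Fin d, ∑ j : Fin d, ∫ θ, θ i ^ 2 * θ j ^ 2 ∂normalizedGaussian d ≤ 1 := by
    have hi : ∀ i : Fin d, Integrable (fun θ : Vec d => ∑ j, θ i ^ 2 * θ j ^ 2)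
        (normalizedGaussian d) := fun i => integrable_finsetSum _ fun j _ => integrable_sq_mul_sq i j
    calc ∑ i : Fin d, ∑ j : Fin d, ∫ θ, θ i ^ 2 * θ j ^ 2 ∂normalizedGaussian d
        = ∫ θ : Vec d, ∑ i, ∑ j, θ i ^ 2 * θ j ^ 2 ∂normalizedGaussian d := by
          rw [integral_finsetSum _ fun i _ => hi i]
          exact Finset.sum_congr rfl fun i _ =>
            (integral_finsetSum _ fun j _ => integrable_sq_mul_sq i j).symm
      _ ≤ ∫ _θ : Vec d, (1 : ℝ) ∂normalizedGaussian d := by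
          refine integral_mono_ae (integrable_finsetSum _ fun i _ => hi i) (integrable_const _) ?_
          filter_upwards [ae_norm_le_one_normalizedGaussian] with θ hθ
          rw [← Finset.sum_mul_sum, ← EuclideanSpace.real_norm_sq_eq]
          exact mul_le_one₀ (pow_le_one₀ (norm_nonneg _) hθ) (by positivity)
            (pow_le_one₀ (norm_nonneg _) hθ)
      _ = 1 := by simp
  -- Each fourth moment is repeated once for every `j`, so the pairwise comparison reduces the bound
  -- to `E ‖θ‖⁴ ≤ 1`.
  have hle : d * ∑ i : Fin d, ∫ θ, θ i ^ 4 ∂normalizedGaussian d ≤ 3 := by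
    calc d * ∑ i : Fin d, ∫ θ, θ i ^ 4 ∂normalizedGaussian d
        = ∑ i : Fin d, ∑ _j : Fin d, ∫ θ, θ i ^ 4 ∂normalizedGaussian d := by
          simp [Finset.mul_sum]
      _ ≤ ∑ i : Fin d, ∑ j : Fin d, 3 * ∫ θ, θ i ^ 2 * θ j ^ 2 ∂normalizedGaussian d :=
          Finset.sum_le_sum fun i _ => Finset.sum_le_sum fun j _ =>
            integral_pow_four_le_three_mul i j
      _ = 3 * ∑ i : Fin d, ∑ j : Fin d, ∫ θ, θ i ^ 2 * θ j ^ 2 ∂normalizedGaussian d := by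
          simp_rw [Finset.mul_sum]
      _ ≤ 3 := by linarith
  rw [hq, le_div_iff₀ hd]
  linarith

lemma integrable_quartic_normalizedGaussian :
    Integrable (quartic : Vec d → ℝ) (normalizedGaussian d) :=
  integrable_finsetSum _ fun i _ => integrable_apply_pow_four i

/-- Applied to initialization and target separately, so their joint law plays no role. -/
lemma quartic_sub_le (v w : Vec d) : quartic (v - w) ≤ 8 * (quartic v + quartic w) := by
  rw [quartic, quartic, quartic, ← Finset.sum_add_distrib, Finset.mul_sum]
  refine Finset.sum_le_sum fun i _ => ?_
  rw [PiLp.sub_apply]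
  nlinarith [sq_nonneg (v i ^ 2 - w i ^ 2), sq_nonneg (v i + w i), sq_nonneg (v i - w i),
    sq_nonneg ((v i + w i) ^ 2), mul_nonneg (sq_nonneg (v i + w i)) (sq_nonneg (v i - w i))]

end NormalizedGaussian

/-! ### Regrouping of independent variables. -/

section Independence

/-- If `X` is independent of `(Y, Z)` and `Y` is independent of `Z`, then `(X, Y)` is independent
of `Z`. -/
lemma indepFun_prodMk_of_indepFun_prodMk {Ω α β γ : Type*} [MeasurableSpace Ω] [MeasurableSpace α]
    [MeasurableSpace β] [MeasurableSpace γ] {P : Measure Ω} [IsProbabilityMeasure P] {X : Ω → α}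
    {Y : Ω → β} {Z : Ω → γ} (hX : Measurable X) (hY : Measurable Y) (hZ : Measurable Z)
    (h : IndepFun X (fun ω => (Y ω, Z ω)) P) (hYZ : IndepFun Y Z P) :
    IndepFun (fun ω => (X ω, Y ω)) Z P := by
  have hXY : IndepFun X Y P := h.comp measurable_id measurable_fst
  rw [indepFun_iff_map_prod_eq_prod_map_map (by fun_prop) (by fun_prop)] at *
  have := Measure.isProbabilityMeasure_map (μ := P) hX.aemeasurable
  have := Measure.isProbabilityMeasure_map (μ := P) hY.aemeasurable
  have := Measure.isProbabilityMeasure_map (μ := P) hZ.aemeasurable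
  rw [hXY]
  apply (MeasurableEquiv.prodAssoc (α := α) (β := β) (γ := γ)).map_measurableEquiv_injective
  rw [Measure.prodAssoc_prod, ← hYZ, ← h, Measure.map_map (by fun_prop) (by fun_prop)]
  rfl

end Independence

/-! ### SignSGD as an instance of the abstract walk. -/

namespace Setting

variable {d : ℕ} {Ω : Type*}

/-- Substituting the label turns the residual into `⟨x, θ - θ⋆⟩ - e`, so the error vector evolves
autonomously. -/
lemma iterate_succ (η : ℝ) (θ₀ θs : Vec d) (x : ℕ → Vec d) (e : ℕ → ℝ) (k : ℕ) :
    iterate η θ₀ θs x e (k + 1) = iterate η θ₀ θs x e k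
      - (η / d) • signStep (iterate η θ₀ θs x e k - θs) (x (k + 1), e (k + 1)) := by
  rw [iterate, signStep, lossGrad, label, inner_sub_right, sub_sub]

/-- The error vector of signSGD. -/
noncomputable def errorVec (η : ℝ) (θ₀ θs : Ω → Vec d) (x : ℕ → Ω → Vec d) (e : ℕ → Ω → ℝ)
    (k : ℕ) (ω : Ω) : Vec d :=
  iterate η (θ₀ ω) (θs ω) (fun k => x k ω) (fun k => e k ω) k - θs ω

lemma errorVec_succ (η : ℝ) (θ₀ θs : Ω → Vec d) (x : ℕ → Ω → Vec d) (e : ℕ → Ω → ℝ)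
    (k : ℕ) (ω : Ω) : errorVec η θ₀ θs x e (k + 1) ω = errorVec η θ₀ θs x e k ω
      - (η / d) • signStep (errorVec η θ₀ θs x e k ω) (x (k + 1) ω, e (k + 1) ω) := by
  rw [errorVec, iterate_succ, errorVec, sub_right_comm]

variable [m : MeasurableSpace Ω] {P : Measure Ω} {η : ℝ}
  {θ₀ θs : Ω → Vec d} {x : ℕ → Ω → Vec d} {e : ℕ → Ω → ℝ}

/-- Initialization, target and the samples up to time `k`. -/
def past (θ₀ θs : Ω → Vec d) (x : ℕ → Ω → Vec d) (e : ℕ → Ω → ℝ) (k : ℕ) (ω : Ω) :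
    (Vec d × Vec d) × (Finset.range (k + 1) → Vec d × ℝ) :=
  ((θ₀ ω, θs ω), fun j => (x j ω, e j ω))

lemma measurable_sample (S : Setting P η θ₀ θs x e) (k : ℕ) :
    Measurable fun ω => (x k ω, e k ω) := (S.measurable_data k).prodMk (S.measurable_noise k)

lemma measurable_past (S : Setting P η θ₀ θs x e) (k : ℕ) : Measurable (past θ₀ θs x e k) :=
  (S.measurable_init.prodMk S.measurable_target).prodMk
    (measurable_pi_lambda _ fun j => S.measurable_sample j)

/-- The natural filtration of signSGD. -/
def filtration (S : Setting P η θ₀ θs x e) : Filtration ℕ m where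
  seq k := MeasurableSpace.comap (past θ₀ θs x e k) inferInstance
  mono' k l hkl := by
    let g : (Vec d × Vec d) × (Finset.range (l + 1) → Vec d × ℝ) →
        (Vec d × Vec d) × (Finset.range (k + 1) → Vec d × ℝ) := fun p =>
      (p.1, fun j => p.2 ⟨j, Finset.range_mono (Nat.succ_le_succ hkl) j.2⟩)
    have hg : Measurable g := measurable_fst.prodMk (measurable_pi_lambda _ fun j =>
      (measurable_pi_apply _).comp measurable_snd)
    show MeasurableSpace.comap (g ∘ past θ₀ θs x e l) _ ≤ _
    rw [← MeasurableSpace.comap_comp]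
    exact MeasurableSpace.comap_mono hg.comap_le
  le' k := (S.measurable_past k).comap_le

lemma measurable_filtration_past (S : Setting P η θ₀ θs x e) (k : ℕ) :
    Measurable[S.filtration k] (past θ₀ θs x e k) := comap_measurable _

lemma measurable_filtration_sample (S : Setting P η θ₀ θs x e) {j k : ℕ} (h : j ≤ k) :
    Measurable[S.filtration k] fun ω => (x j ω, e j ω) :=
  ((measurable_pi_apply (⟨j, Finset.mem_range.2 (Nat.lt_succ_of_le h)⟩ : Finset.range (k + 1))).comp
    measurable_snd).comp (S.measurable_filtration_past k)

lemma indep_filtration [IsProbabilityMeasure P] (S : Setting P η θ₀ θs x e) (k : ℕ) :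
    Indep (S.filtration k)
      (MeasurableSpace.comap (fun ω => (x (k + 1) ω, e (k + 1) ω)) inferInstance) P := by
  have hX : Measurable fun ω => (θ₀ ω, θs ω) := S.measurable_init.prodMk S.measurable_target
  have hY : Measurable fun ω (j : Finset.range (k + 1)) => (x j ω, e j ω) :=
    measurable_pi_lambda _ fun j => S.measurable_sample j
  have h1 : IndepFun (fun ω => (θ₀ ω, θs ω)) (fun ω =>
      ((fun j : Finset.range (k + 1) => (x j ω, e j ω)), (x (k + 1) ω, e (k + 1) ω))) P :=
    S.indepFun_init.comp (φ := id) (ψ := fun s : ℕ → Vec d × ℝ =>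
      ((fun j : Finset.range (k + 1) => s j), s (k + 1))) measurable_id (by fun_prop)
  have h2 : IndepFun (fun ω (j : Finset.range (k + 1)) => (x j ω, e j ω))
      (fun ω => (x (k + 1) ω, e (k + 1) ω)) P :=
    (S.iIndepFun_sample.indepFun_finset (Finset.range (k + 1)) {k + 1} (by simp)
      S.measurable_sample).comp (φ := id)
      (ψ := fun s : ({k + 1} : Finset ℕ) → Vec d × ℝ => s ⟨k + 1, by simp⟩)
      measurable_id (measurable_pi_apply _)
  have h3 := indepFun_prodMk_of_indepFun_prodMk hX hY (S.measurable_sample (k + 1)) h1 h2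
  rw [IndepFun_iff_Indep] at h3
  exact h3

lemma measurable_filtration_errorVec (S : Setting P η θ₀ θs x e) (k : ℕ) :
    Measurable[S.filtration k] (errorVec η θ₀ θs x e k) := by
  induction k with
  | zero =>
    have h := measurable_fst.comp (S.measurable_filtration_past 0)
    exact (measurable_fst.comp h).sub (measurable_snd.comp h)
  | succ k ih =>
    have h1 : Measurable[S.filtration (k + 1)] (errorVec η θ₀ θs x e k) :=
      ih.mono (S.filtration.mono (Nat.le_succ k)) le_rfl
    have h2 := h1.sub ((measurable_signStep.comp
      (h1.prodMk (S.measurable_filtration_sample (le_refl (k + 1))))).const_smul (η / d))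
    have h3 : errorVec η θ₀ θs x e (k + 1) = fun ω => errorVec η θ₀ θs x e k ω
      - (η / d) • signStep (errorVec η θ₀ θs x e k ω) (x (k + 1) ω, e (k + 1) ω) :=
      funext fun ω => errorVec_succ η θ₀ θs x e k ω
    rw [h3]
    exact h2

lemma ae_norm_init_le_one (S : Setting P η θ₀ θs x e) : ∀ᵐ ω ∂P, ‖θ₀ ω‖ ≤ 1 :=
  ae_of_ae_map S.measurable_init.aemeasurable (by
    rw [S.law_init]; exact ae_norm_le_one_normalizedGaussian)

lemma ae_norm_target_le_one (S : Setting P η θ₀ θs x e) : ∀ᵐ ω ∂P, ‖θs ω‖ ≤ 1 :=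
  ae_of_ae_map S.measurable_target.aemeasurable (by
    rw [S.law_target]; exact ae_norm_le_one_normalizedGaussian)

/-- The index shift matters: the past at time `k` contains samples `0` to `k`, and the fresh sample
of the walk at time `k` is number `k + 1`. -/
lemma signWalk [IsProbabilityMeasure P] (S : Setting P η θ₀ θs x e) (hη : 0 < η) :
    SignWalk P η S.filtration (errorVec η θ₀ θs x e) (fun k ω => (x (k + 1) ω, e (k + 1) ω)) where
  pos := hη
  adapted := S.measurable_filtration_errorVec
  measurable_sample k := S.measurable_sample (k + 1)
  law k := S.law_sample (k + 1)
  indep := S.indep_filtration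
  step k ω := errorVec_succ η θ₀ θs x e k ω
  init := by
    filter_upwards [S.ae_norm_init_le_one, S.ae_norm_target_le_one] with ω h1 h2
    exact (norm_sub_le (θ₀ ω) (θs ω)).trans (by linarith)

/-- The constant is `48 = 8 (3 + 3)`. -/
lemma integral_quartic_init_le [IsProbabilityMeasure P] (S : Setting P η θ₀ θs x e) (hη : 0 < η) :
    ∫ ω, quartic (errorVec η θ₀ θs x e 0 ω) ∂P ≤ 48 / d := by
  have key : ∀ θ : Ω → Vec d, Measurable θ → P.map θ = normalizedGaussian d →
      Integrable (fun ω => quartic (θ ω)) P ∧ ∫ ω, quartic (θ ω) ∂P ≤ 3 / d := by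
    intro θ hθ hlaw
    have hq := integrable_quartic_normalizedGaussian (d := d)
    rw [← hlaw] at hq
    refine ⟨hq.comp_measurable hθ, ?_⟩
    rw [← integral_map (f := quartic) hθ.aemeasurable measurable_quartic.aestronglyMeasurable, hlaw]
    exact integral_quartic_normalizedGaussian_le
  obtain ⟨i1, b1⟩ := key θ₀ S.measurable_init S.law_init
  obtain ⟨i2, b2⟩ := key θs S.measurable_target S.law_target
  calc ∫ ω, quartic (errorVec η θ₀ θs x e 0 ω) ∂P
      ≤ ∫ ω, 8 * (quartic (θ₀ ω) + quartic (θs ω)) ∂P :=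
        integral_mono ((S.signWalk hη).integrable_quartic 0) ((i1.add i2).const_mul 8)
          fun ω => quartic_sub_le _ _
    _ = 8 * (∫ ω, quartic (θ₀ ω) ∂P + ∫ ω, quartic (θs ω) ∂P) := by
        rw [integral_const_mul, integral_add i1 i2]
    _ ≤ 8 * (3 / d + 3 / d) := by gcongr
    _ = 48 / d := by ring

end Setting

/-! ### Comparison of the walk with the risk equation. -/

namespace SignWalk

variable {d : ℕ} {Ω : Type*} [m : MeasurableSpace Ω] {P : Measure Ω} {η : ℝ} {𝒢 : Filtration ℕ m}
  {V : ℕ → Ω → Vec d} {Z : ℕ → Ω → Vec d × ℝ}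

/-- The deviation of the drift of the risk from the right-hand side of the risk equation. -/
noncomputable def driftError (η : ℝ) (V : ℕ → Ω → Vec d) (k : ℕ) (ω : Ω) : ℝ :=
  η / d * (drift η (V k ω) - 2 / Real.pi * (‖V k ω‖ ^ 2 / Real.sqrt (‖V k ω‖ ^ 2 + η ^ 2)))

lemma abs_driftError_le (W : SignWalk P η 𝒢 V Z) (k : ℕ) (ω : Ω) :
    |driftError η V k ω| ≤ η / d * (cubicConst η * quartic (V k ω)) := by
  rw [driftError, abs_mul, abs_of_nonneg W.div_nonneg]
  exact mul_le_mul_of_nonneg_left (abs_drift_sub_le W.pos _) W.div_nonneg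

/-- The risk follows the Euler scheme of the risk equation up to noise and drift error. -/
lemma risk_step (W : SignWalk P η 𝒢 V Z) (hd : 0 < d) {k : ℕ} {ω : Ω}
    (hs : ∀ i, signStep (V k ω) (Z k ω) i ^ 2 = 1) :
    ‖V (k + 1) ω‖ ^ 2 / 2 = ‖V k ω‖ ^ 2 / 2 + 1 / d * riskRate η (‖V k ω‖ ^ 2 / 2)
      + -noise η V Z k ω + -driftError η V k ω := by
  have hd' : (0 : ℝ) < d := by exact_mod_cast hd
  have hS : ‖signStep (V k ω) (Z k ω)‖ ^ 2 = d := by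
    rw [EuclideanSpace.real_norm_sq_eq, Finset.sum_congr rfl fun i _ => hs i]
    simp
  have hsq : 0 < Real.sqrt (‖V k ω‖ ^ 2 + η ^ 2) :=
    Real.sqrt_pos.2 (by have := W.pos; positivity)
  rw [W.step, norm_sub_sq_real, inner_smul_right, norm_smul, mul_pow, hS, Real.norm_eq_abs, sq_abs,
    noise, centeredStep, driftError, riskRate, mul_div_cancel₀ _ (two_ne_zero' ℝ)]
  have hp := Real.pi_pos
  field_simp
  ring

/-- Pathwise statement: outside a null set, the two smallness conditions supply the perturbation
bounds of the Euler comparison, with both `A` and `B` equal to `α`. -/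
lemma ae_abs_risk_sub_lt [IsProbabilityMeasure P] (W : SignWalk P η 𝒢 V Z) (hd : 0 < d)
    {T α : ℝ} (hT : 0 ≤ T) (hα : 0 ≤ α) {ρ : Ω → ℝ → ℝ}
    (hρ : ∀ ω, IsRiskSolution η (‖V 0 ω‖ ^ 2 / 2) (ρ ω)) :
    ∀ᵐ ω ∂P, (∀ k ≤ ⌊T * d⌋₊, |noiseSum η V Z k ω| < α) →
      ∑ k ∈ Finset.range ⌊T * d⌋₊, η / d * (cubicConst η * quartic (V k ω)) < α →
      ⨆ t : Set.Icc (0 : ℝ) T, |‖V ⌊(t : ℝ) * d⌋₊ ω‖ ^ 2 / 2 - ρ ω t|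
        ≤ α + (2 * T * α + α + 2 * T * speed η 2 T / d) * Real.exp (2 * T)
          + speed η 2 T / d := by
  filter_upwards [ae_all_iff.2 W.ae_signStep_sq, W.init] with ω hs h0 hM hQ
  have : Nonempty (Set.Icc (0 : ℝ) T) := ⟨⟨0, le_rfl, hT⟩⟩
  refine ciSup_le fun t => ?_
  refine abs_sub_riskSolution_le (R := fun k => ‖V k ω‖ ^ 2 / 2)
    (a := fun k => -noise η V Z k ω) (b := fun k => -driftError η V k ω) W.pos hd hα (hρ ω)
    (fun k => by positivity) (by nlinarith [norm_nonneg (V 0 ω)])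
    (fun k => W.risk_step hd (hs k)) (fun n hn => ?_) ?_ t.2
  · rw [Finset.sum_neg_distrib, abs_neg]
    exact (hM n hn).le
  · refine (Finset.sum_le_sum fun k _ => ?_).trans hQ.le
    rw [abs_neg]
    exact W.abs_driftError_le k ω

lemma measure_le_iSup_abs_risk_sub_le [IsProbabilityMeasure P] (W : SignWalk P η 𝒢 V Z)
    (hd : 0 < d) {T α ε q : ℝ} (hT : 0 ≤ T) (hα : 0 < α) (hq0 : 0 ≤ q)
    (hq : ∫ ω, quartic (V 0 ω) ∂P ≤ q / d) {ρ : Ω → ℝ → ℝ}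
    (hρ : ∀ ω, IsRiskSolution η (‖V 0 ω‖ ^ 2 / 2) (ρ ω))
    (hε : α + (2 * T * α + α + 2 * T * speed η 2 T / d) * Real.exp (2 * T)
          + speed η 2 T / d < ε) :
    P {ω | ε ≤ ⨆ t : Set.Icc (0 : ℝ) T, |‖V ⌊(t : ℝ) * d⌋₊ ω‖ ^ 2 / 2 - ρ ω t|}
      ≤ ENNReal.ofReal (T * η ^ 2 * (4 + T * η ^ 2) / α ^ 2 / d)
        + ENNReal.ofReal (T * η * cubicConst η
          * (q + T * (6 * η ^ 2 * (4 + T * η ^ 2) + η ^ 4)) / α / d) := by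
  refine le_trans ?_ (add_le_add (W.measure_exists_le_abs_noiseSum_le hd hT hα)
    (W.measure_le_sum_quartic_le hd hT hq0 hq hα))
  -- Only an almost sure inclusion of sets is used, so neither the supremum nor `ρ` has to be
  -- measurable in `ω`.
  refine le_trans (measure_mono_ae ?_) (measure_union_le _ _)
  filter_upwards [W.ae_abs_risk_sub_lt hd hT hα.le hρ] with ω hω hmem
  by_contra hcon
  have h1 : ∀ k ≤ ⌊T * d⌋₊, |noiseSum η V Z k ω| < α := fun k hk =>
    not_le.1 fun h => hcon (Or.inl ⟨k, hk, h⟩)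
  have h2 : ∑ k ∈ Finset.range ⌊T * d⌋₊, η / d * (cubicConst η * quartic (V k ω)) < α :=
    not_le.1 fun h => hcon (Or.inr h)
  exact absurd (le_trans hmem (hω h1 h2)) (not_le.2 hε)

end SignWalk

end IsotropicSignSGD

/-! ### Passage to the limit in the dimension. -/

theorem mainTheorem4
    (η : ℝ) (hη : 0 < η)
    {Ω : ℕ → Type*} [∀ d, MeasurableSpace (Ω d)]
    (P : ∀ d, Measure (Ω d)) [∀ d, IsProbabilityMeasure (P d)]
    (θ₀ θs : ∀ d, Ω d → IsotropicSignSGD.Vec d)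
    (x : ∀ d, ℕ → Ω d → IsotropicSignSGD.Vec d)
    (e : ∀ d, ℕ → Ω d → ℝ)
    (hsetting : ∀ d, IsotropicSignSGD.Setting (P d) η (θ₀ d) (θs d) (x d) (e d))
    (ρ : ∀ d, Ω d → ℝ → ℝ)
    (hρ : ∀ d ω, IsotropicSignSGD.IsRiskSolution η
      (IsotropicSignSGD.risk (θs d ω) (θ₀ d ω)) (ρ d ω))
    (T : ℝ) (hT : 0 < T) (ε : ℝ) (hε : 0 < ε) :
    Tendsto
      (fun d : ℕ => P d {ω | ε ≤ ⨆ t : Set.Icc (0 : ℝ) T,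
        |IsotropicSignSGD.risk (θs d ω)
            (IsotropicSignSGD.iterate η (θ₀ d ω) (θs d ω) (fun k => x d k ω) (fun k => e d k ω)
              ⌊(t : ℝ) * (d : ℝ)⌋₊)
          - ρ d ω t|})
      atTop (𝓝 0) := by
  have hdiv : ∀ c : ℝ, Tendsto (fun d : ℕ => c / (d : ℝ)) atTop (𝓝 0) := fun c =>
    tendsto_const_nhds.div_atTop tendsto_natCast_atTop_atTop
  -- The part of the deterministic bound proportional to `α` is `α κ`, so `α = ε / (2 κ)` spends
  -- half of `ε`. The discretisation part `c / d` falls below the other half for large `d`.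
  set κ := 1 + (2 * T + 1) * Real.exp (2 * T) with hκ
  have hκ0 : 0 < κ := by positivity
  set α := ε / (2 * κ) with hα
  have hα0 : 0 < α := by positivity
  have hακ : α * κ = ε / 2 := by rw [hα]; field_simp
  set c := 2 * T * IsotropicSignSGD.speed η 2 T * Real.exp (2 * T)
    + IsotropicSignSGD.speed η 2 T with hc
  have hlim : Tendsto (fun d : ℕ =>
      ENNReal.ofReal (T * η ^ 2 * (4 + T * η ^ 2) / α ^ 2 / d)
        + ENNReal.ofReal (T * η * IsotropicSignSGD.cubicConst η
          * (48 + T * (6 * η ^ 2 * (4 + T * η ^ 2) + η ^ 4)) / α / d)) atTop (𝓝 0) := by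
    have := (ENNReal.tendsto_ofReal (hdiv (T * η ^ 2 * (4 + T * η ^ 2) / α ^ 2))).add
      (ENNReal.tendsto_ofReal (hdiv (T * η * IsotropicSignSGD.cubicConst η
          * (48 + T * (6 * η ^ 2 * (4 + T * η ^ 2) + η ^ 4)) / α)))
    simpa using this
  refine tendsto_of_tendsto_of_tendsto_of_le_of_le' tendsto_const_nhds hlim
    (Eventually.of_forall fun _ => zero_le) ?_
  filter_upwards [eventually_gt_atTop 0, (hdiv c).eventually (gt_mem_nhds (half_pos hε))]
    with d hd hcd
  refine ((hsetting d).signWalk hη).measure_le_iSup_abs_risk_sub_le hd hT.le hα0 (by norm_num)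
    ((hsetting d).integral_quartic_init_le hη) (hρ d) ?_
  have : α + (2 * T * α + α + 2 * T * IsotropicSignSGD.speed η 2 T / d) * Real.exp (2 * T)
      + IsotropicSignSGD.speed η 2 T / d = α * κ + c / d := by
    rw [hκ, hc]; ring
  rw [this, hακ]
  linarith
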